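/- Setting. Let $N$ be a unital C*-algebra, $N\neq 0$, with centre $\mathbb C\cdot 1$ (for instance a type III factor). For unital $*$-endomorphisms $\rho,\sigma$ of $N$ let $\mathrm{Hom}(\rho,\sigma)=\{t\in N:\ t\rho(a)=\sigma(a)t\ \text{ for all } a\in N\}$, and write $\rho\sigma=\rho\circ\sigma$. The dimension $\dim(\rho)\in[0,\infty]$ is the infimum of all $d\ge 0$ for which there are a unital $*$-endomorphism $\bar\rho$ and $w\in\mathrm{Hom}(\mathrm{id},\bar\rho\rho)$, $v\in\mathrm{Hom}(\mathrm{id},\rho\bar\rho)$ with $v^*\rho(w)=1=w^*\bar\rho(v)$ and $w^*w=v^*v=d\cdot 1$. Let $\mathcal C$ be a set of unital $*$-endomorphisms of $N$ containing $\mathrm{id}$ and closed under composition, regarded as a full monoidal subcategory (with $t_1\times t_2=t_1\rho_1(t_2)$ for $t_i\in\mathrm{Hom}(\rho_i,\sigma_i)$), with a unitary braiding $\varepsilon_{\rho,\sigma}\in\mathrm{Hom}(\rho\sigma,\sigma\rho)$ (natural in both variables and satisfying both hexagon identities); put $\varepsilon^+_{\rho,\sigma}=\varepsilon_{\rho,\sigma}$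 and $\varepsilon^-_{\rho,\sigma}=\varepsilon_{\sigma,\rho}^*$. A Q-system is a triple $A=(\theta,w,x)$ with $\theta$ a unital $*$-endomorphism of $N$ with $\dim(\theta)<\infty$, $w\in\mathrm{Hom}(\mathrm{id},\theta)$, $x\in\mathrm{Hom}(\theta,\theta^2)$, and $$w^*x=\theta(w^*)x=1,\quad xx=\theta(x)x,\quad xx^*=\theta(x^*)x,\quad w^*w=x^*x=d_A\cdot 1,\qquad d_A=\sqrt{\dim(\theta)};$$ it is a Q-system in $\mathcal C$ if $\theta\in\mathcal C$. The extension of $N$ given by $A$ is the unital $*$-algebra $B$ generated by $\iota(N)\cong N$ and one element $v$ with the defining relations $v^*=\iota(w^*x^*)v$, $vv=\iota(x)v$, $\iota(w^*)v=1$, $v\iota(n)=\iota(\theta(n))v$; every element of $B$ is of the form $\iota(n)v$ for a unique $n\in N$. A Q-system $A'=(\theta',w',x')$ is an intermediate Q-system of $A$ by way of an isometry $s\in\mathrm{Hom}(\theta',\theta)$ if the projection $p=ss^*$ satisfies $pw=w$ and $p\theta(p)x=pxp=\theta(p)xp$, and $$\theta'=s^*\theta(\cdot)s,\qquad w'=(d_{A'}/d_A)^{1/2}\,s^*w,\qquad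 x'=(d_A/d_{A'})^{1/2}\,s^*\theta(s^*)xs .$$ Statement. Let $A_1=(\theta_1,w_1,x_1)$ and $A_2=(\theta_2,w_2,x_2)$ be Q-systems in $\mathcal C$, with extensions $(B_1,\iota_1,v_1)$ and $(B_2,\iota_2,v_2)$ of $N$. Then, for either choice of the sign $\pm$: (a) The triple $$A_1\times^\pm A_2=\bigl(\theta_1\theta_2,\ \theta_1(w_2)w_1,\ \theta_1(\varepsilon^\pm_{\theta_1,\theta_2})\,x_1\,\theta_1(x_2)\bigr)$$ is a Q-system in $\mathcal C$. Let $d$ be its dimension $d_{A_1\times^\pm A_2}$, and let $(C^\pm,\iota,v)$ be its extension of $N$. (b) $A_1$ and $A_2$ are intermediate Q-systems of $A_1\times^\pm A_2$, by way of some isometries $s_1$ and $s_2$, and accordingly $C^\pm$ contains $B_1$ and $B_2$ as intermediate extensions: there are injective unital $*$-homomorphisms $j_i:B_i\to C^\pm$ with $j_i\circ\iota_i=\iota$ and $j_i(v_i)=(d/d_{A_i})^{1/2}\,\iota(s_i^*)v$ ($i=1,2$). (c) $C^\pm$ is the quotient of the free product of the unital algebras $B_1$ and $B_2$ by the relations $\iota_1(n)=\iota_2(n)$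 for $n\in N$ and the single relation $v_2v_1=\iota_1(\varepsilon^\pm_{\theta_1,\theta_2})\,v_1v_2$; that is, the homomorphism from the free product to $C^\pm$ defined by $j_1$ and $j_2$ induces an isomorphism from this quotient onto $C^\pm$. -/

import Mathlib

open scoped ENNReal NNReal

namespace BraidedProduct

universe u

section Intertwiners

variable {N : Type u} [CStarAlgebra N]

/-- Intertwiners `t : φ → ψ` between unital `*`-endomorphisms: `t φ(a) = ψ(a) t` for all `a`. -/
def Hom (φ ψ : N →⋆ₐ[ℂ] N) : Set N := {t | ∀ a, t * φ a = ψ a * t}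

/-- `(w, v)` solves the conjugacy relations for `φ` and `φ'`, with normalization `d`.
The product of endomorphisms is composition and `1` is the identity endomorphism. -/
structure IsConjugateSolution (φ φ' : N →⋆ₐ[ℂ] N) (w v : N) (d : ℝ≥0) : Prop where
  w_mem : w ∈ Hom 1 (φ' * φ)
  v_mem : v ∈ Hom 1 (φ * φ')
  conj_left : star v * φ w = 1
  conj_right : star w * φ' v = 1
  norm_w : star w * w = ((d : ℝ) : ℂ) • (1 : N)
  norm_v : star v * v = ((d : ℝ) : ℂ) • (1 : N)

/-- The dimension of `φ`: the infimum of the normalizations of all solutions of the conjugacy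
relations, over all conjugates; it is `∞` if `φ` has no conjugate. -/
noncomputable def dim (φ : N →⋆ₐ[ℂ] N) : ℝ≥0∞ :=
  sInf {D : ℝ≥0∞ | ∃ (d : ℝ≥0) (φ' : N →⋆ₐ[ℂ] N) (w v : N),
    IsConjugateSolution φ φ' w v d ∧ D = d}

end Intertwiners

/-- A Q-system `(θ, w, x)`: `θ` is an endomorphism of finite dimension, `w : id → θ`,
`x : θ → θ²`, with the unit property, associativity, the Frobenius property and standardness. -/
structure QSystem (N : Type u) [CStarAlgebra N] where
  θ : N →⋆ₐ[ℂ] N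
  w : N
  x : N
  dim_ne_top : dim θ ≠ ∞
  w_mem : w ∈ Hom 1 θ
  x_mem : x ∈ Hom θ (θ * θ)
  unit_left : star w * x = 1
  unit_right : θ (star w) * x = 1
  assoc : x * x = θ x * x
  frobenius : x * star x = θ (star x) * x
  standard_w : star w * w = ((√(dim θ).toReal : ℝ) : ℂ) • (1 : N)
  standard_x : star x * x = ((√(dim θ).toReal : ℝ) : ℂ) • (1 : N)

/-- A full subcategory of the category of endomorphisms of `N` that contains the identity and is
closed under composition, with a unitary braiding `ε ρ σ : ρσ → σρ`. The monoidal product of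
morphisms `t₁ : ρ₁ → σ₁` and `t₂ : ρ₂ → σ₂` is `t₁ ρ₁(t₂)`. -/
structure BraidedCat (N : Type u) [CStarAlgebra N] where
  obj : Submonoid (N →⋆ₐ[ℂ] N)
  ε : obj → obj → N
  ε_unitary : ∀ ρ σ, ε ρ σ ∈ unitary N
  ε_mem : ∀ ρ σ : obj, ε ρ σ ∈ Hom (ρ * σ : obj) (σ * ρ : obj)
  natural_left : ∀ (ρ ρ' σ : obj) (t : N), t ∈ Hom (ρ : N →⋆ₐ[ℂ] N) ρ' →
    ε ρ' σ * t = (σ : N →⋆ₐ[ℂ] N) t * ε ρ σ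
  natural_right : ∀ (ρ σ σ' : obj) (t : N), t ∈ Hom (σ : N →⋆ₐ[ℂ] N) σ' →
    ε ρ σ' * (ρ : N →⋆ₐ[ℂ] N) t = t * ε ρ σ
  hexagon_left : ∀ ρ σ τ : obj, ε (ρ * σ) τ = ε ρ τ * (ρ : N →⋆ₐ[ℂ] N) (ε σ τ)
  hexagon_right : ∀ ρ σ τ : obj, ε ρ (σ * τ) = (σ : N →⋆ₐ[ℂ] N) (ε ρ τ) * ε ρ σ

/-- The two signs `±`. -/
inductive Sign
  | plus
  | minus

/-- The braiding `ε⁺` and the opposite braiding `ε⁻`, given by `ε⁻ ρ σ = (ε σ ρ)*`. -/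
def BraidedCat.braiding {N : Type u} [CStarAlgebra N] (C : BraidedCat N) :
    Sign → C.obj → C.obj → N
  | .plus, ρ, σ => C.ε ρ σ
  | .minus, ρ, σ => star (C.ε σ ρ)

namespace QSystem

variable {N : Type u} [CStarAlgebra N]

/-- The dimension `d = √(dim θ)` of the Q-system. -/
noncomputable def d (A : QSystem N) : ℝ := √(dim A.θ).toReal

/-- `A'` is an intermediate Q-system of `A`, by way of the isometry `s : θ' → θ`: the projection
`p = s s*` satisfies `p w = w` and `p θ(p) x = p x p = θ(p) x p`, and `A'` is the Q-system obtained
by reducing `A` with `s`, so that `θ' = s* θ(·) s`, and `w'`, `x'` are the normalized multiples of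
`s* w` and `s* θ(s*) x s`. -/
structure IsIntermediate (A' A : QSystem N) (s : N) : Prop where
  isometry : star s * s = 1
  s_mem : s ∈ Hom A'.θ A.θ
  θ_eq : ∀ a, A'.θ a = star s * A.θ a * s
  p_w : s * star s * A.w = A.w
  p_x : s * star s * A.θ (s * star s) * A.x = s * star s * A.x * (s * star s)
  p_x' : s * star s * A.x * (s * star s) = A.θ (s * star s) * A.x * (s * star s)
  w_eq : A'.w = ((√(A'.d / A.d) : ℝ) : ℂ) • (star s * A.w)
  x_eq : A'.x = ((√(A.d / A'.d) : ℝ) : ℂ) • (star s * A.θ (star s) * A.x * s)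

/-- The extension of `N` given by the Q-system `A`: the unital `*`-algebra generated by `N` and one
element `v` with the relations `v* = w* x* v`, `v v = x v`, `w* v = 1`, `v a = θ(a) v`.
Each of its elements is of the form `a v` for a unique `a` in `N`, and the element `a v` is stored
here as its coefficient `a`. -/
@[ext]
structure Ext (A : QSystem N) where
  /-- The element `a v` of the extension. -/
  mkV ::
  /-- The coefficient `a` of `a v`. -/
  coeff : N

namespace Ext

variable {A : QSystem N}

instance : Zero A.Ext := ⟨⟨0⟩⟩
instance : Add A.Ext := ⟨fun b c => ⟨b.coeff + c.coeff⟩⟩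
instance : Neg A.Ext := ⟨fun b => ⟨-b.coeff⟩⟩
instance : Sub A.Ext := ⟨fun b c => ⟨b.coeff - c.coeff⟩⟩
instance : SMul ℕ A.Ext := ⟨fun n b => ⟨n • b.coeff⟩⟩
instance : SMul ℤ A.Ext := ⟨fun n b => ⟨n • b.coeff⟩⟩
instance : SMul ℂ A.Ext := ⟨fun z b => ⟨z • b.coeff⟩⟩
/-- `1 = w* v`. -/
instance : One A.Ext := ⟨⟨star A.w⟩⟩
/-- `(a v) (b v) = a θ(b) v v = a θ(b) x v`. -/
instance : Mul A.Ext := ⟨fun b c => ⟨b.coeff * A.θ c.coeff * A.x⟩⟩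
/-- `(a v)* = v* a* = w* x* v a* = w* x* θ(a*) v`. -/
instance : Star A.Ext := ⟨fun b => ⟨star A.w * star A.x * A.θ (star b.coeff)⟩⟩

@[simp] lemma coeff_zero : (0 : A.Ext).coeff = 0 := rfl
@[simp] lemma coeff_add (b c : A.Ext) : (b + c).coeff = b.coeff + c.coeff := rfl
@[simp] lemma coeff_smul (z : ℂ) (b : A.Ext) : (z • b).coeff = z • b.coeff := rfl
@[simp] lemma coeff_one : (1 : A.Ext).coeff = star A.w := rfl
@[simp] lemma coeff_mul (b c : A.Ext) : (b * c).coeff = b.coeff * A.θ c.coeff * A.x := rfl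
@[simp] lemma coeff_star (b : A.Ext) :
    (star b).coeff = star A.w * star A.x * A.θ (star b.coeff) := rfl

instance : AddCommGroup A.Ext :=
  Function.Injective.addCommGroup Ext.coeff (fun _ _ h => Ext.ext h) rfl (fun _ _ => rfl)
    (fun _ => rfl) (fun _ _ => rfl) (fun _ _ => rfl) (fun _ _ => rfl)

lemma w_comm (A : QSystem N) (a : N) : A.w * a = A.θ a * A.w := A.w_mem a
lemma x_comm (A : QSystem N) (a : N) : A.x * A.θ a = A.θ (A.θ a) * A.x := A.x_mem a
lemma star_w_comm (A : QSystem N) (a : N) : star A.w * A.θ a = a * star A.w := by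
  have h := congrArg star (w_comm A (star a))
  simpa [← map_star] using h.symm
lemma star_x_comm (A : QSystem N) (a : N) : star A.x * A.θ (A.θ a) = A.θ a * star A.x := by
  have h := congrArg star (x_comm A (star a))
  simpa [← map_star] using h.symm

noncomputable instance : Ring A.Ext where
  __ := (inferInstance : AddCommGroup A.Ext)
  left_distrib a b c := by ext; simp [mul_add, add_mul]
  right_distrib a b c := by ext; simp [add_mul]
  zero_mul a := by ext; simp
  mul_zero a := by ext; simp
  mul_assoc a b c := by
    ext
    simp only [coeff_mul, map_mul]
    have h := x_comm A c.coeff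
    have h' := A.assoc
    calc a.coeff * A.θ b.coeff * A.x * A.θ c.coeff * A.x
        = a.coeff * A.θ b.coeff * (A.x * A.θ c.coeff) * A.x := by noncomm_ring
      _ = a.coeff * A.θ b.coeff * A.θ (A.θ c.coeff) * (A.x * A.x) := by rw [h]; noncomm_ring
      _ = a.coeff * (A.θ b.coeff * A.θ (A.θ c.coeff) * A.θ A.x) * A.x := by
          rw [h']; noncomm_ring
  one_mul a := by
    ext
    simp only [coeff_mul, coeff_one]
    rw [star_w_comm, mul_assoc, A.unit_left, mul_one]
  mul_one a := by
    ext
    simp only [coeff_mul, coeff_one]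
    rw [mul_assoc, A.unit_right, mul_one]

noncomputable instance : Algebra ℂ A.Ext :=
  letI : Module ℂ A.Ext :=
    Function.Injective.module ℂ ⟨⟨Ext.coeff, rfl⟩, fun _ _ => rfl⟩ (fun _ _ h => Ext.ext h)
      (fun _ _ => rfl)
  Algebra.ofModule (fun z a b => by ext; simp) (fun z a b => by ext; simp)

noncomputable instance : StarRing A.Ext where
  star_involutive a := by
    ext
    simp only [coeff_star]
    simp only [star_mul, star_star, map_mul, ← map_star]
    have h1 : star A.x * A.θ A.x = A.x * star A.x := by
      have h := congrArg star A.frobenius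
      simpa [← map_star] using h.symm
    have h2 : star A.x * A.θ A.w = 1 := by
      have h := congrArg star A.unit_right
      simpa [← map_star] using h
    calc star A.w * star A.x * (A.θ (A.θ a.coeff) * (A.θ A.x * A.θ A.w))
        = star A.w * (star A.x * A.θ (A.θ a.coeff)) * A.θ A.x * A.θ A.w := by noncomm_ring
      _ = (star A.w * A.θ a.coeff) * (star A.x * A.θ A.x) * A.θ A.w := by
          rw [star_x_comm]; noncomm_ring
      _ = a.coeff * (star A.w * A.x) * (star A.x * A.θ A.w) := by
          rw [star_w_comm, h1]; noncomm_ring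
      _ = a.coeff := by rw [A.unit_left, h2]; simp
  star_mul a b := by
    ext
    simp only [coeff_star, coeff_mul]
    simp only [star_mul, map_mul, ← map_star]
    have h0 : star A.x * star A.x = star A.x * A.θ (star A.x) := by
      have h := congrArg star A.assoc
      simpa [← map_star] using h
    have h1 : A.θ (star A.w) * A.θ (star A.x) * A.x = star A.x := by
      rw [mul_assoc, ← A.frobenius, ← mul_assoc, A.unit_right, one_mul]
    calc star A.w * star A.x *
          (A.θ (star A.x) * (A.θ (A.θ (star b.coeff)) * A.θ (star a.coeff)))
        = star A.w * (star A.x * A.θ (star A.x)) * A.θ (A.θ (star b.coeff))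
            * A.θ (star a.coeff) := by noncomm_ring
      _ = star A.w * star A.x * (star A.x * A.θ (A.θ (star b.coeff))) * A.θ (star a.coeff) := by
          rw [← h0]; noncomm_ring
      _ = star A.w * star A.x * A.θ (star b.coeff) *
            (A.θ (star A.w) * A.θ (star A.x) * A.x) * A.θ (star a.coeff) := by
          rw [star_x_comm, h1]; noncomm_ring
      _ = star A.w * star A.x * A.θ (star b.coeff) *
            (A.θ (star A.w) * A.θ (star A.x)) * (A.x * A.θ (star a.coeff)) := by noncomm_ring
      _ = _ := by rw [x_comm]; noncomm_ring
  star_add a b := by ext; simp [mul_add]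

instance : StarModule ℂ A.Ext where
  star_smul z a := by ext; simp

end Ext

/-- The generator `v` of the extension. -/
def v (A : QSystem N) : A.Ext := ⟨1⟩

/-- The embedding `ι` of `N` into the extension, `ι(a) = a w* v`. -/
noncomputable def ι (A : QSystem N) : N →⋆ₐ[ℂ] A.Ext where
  toFun a := ⟨a * star A.w⟩
  map_one' := by ext; simp
  map_mul' a b := by
    ext
    simp only [Ext.coeff_mul, map_mul]
    rw [mul_assoc (a * star A.w), mul_assoc (A.θ b), A.unit_right, mul_one, mul_assoc a (star A.w),
      Ext.star_w_comm, mul_assoc]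
  map_zero' := by ext; simp
  map_add' a b := by ext; simp [add_mul]
  commutes' z := by
    ext
    simp [Algebra.algebraMap_eq_smul_one]
  map_star' a := by
    ext
    simp only [Ext.coeff_star, star_mul, star_star, map_mul]
    have h2 : star A.x * A.θ A.w = 1 := by
      have h := congrArg star A.unit_right
      simpa [← map_star] using h
    rw [mul_assoc, ← mul_assoc (star A.x), h2, one_mul, Ext.star_w_comm]

/-- Every element of the extension is `ι(a) v` for its coefficient `a`. -/
lemma ι_mul_v (A : QSystem N) (a : N) : A.ι a * A.v = ⟨a⟩ := by
  ext
  change a * star A.w * A.θ 1 * A.x = a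
  rw [map_one, mul_one, mul_assoc, A.unit_left, mul_one]

/-- The relations between `v` and `N`. -/
lemma v_relations (A : QSystem N) :
    star A.v = A.ι (star A.w * star A.x) * A.v ∧ A.v * A.v = A.ι A.x * A.v ∧
      A.ι (star A.w) * A.v = 1 ∧ ∀ a, A.v * A.ι a = A.ι (A.θ a) * A.v := by
  simp only [ι_mul_v]
  refine ⟨?_, ?_, rfl, fun a => ?_⟩
  · ext; simp [v]
  · ext; simp [v]
  · ext
    change 1 * A.θ (a * star A.w) * A.x = A.θ a
    rw [one_mul, map_mul, mul_assoc, A.unit_right, mul_one]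

/-- The relations are defining: the extension is the universal algebra in which they hold. -/
lemma existsUnique_lift (A : QSystem N) {D : Type*} [Ring D] [Algebra ℂ D] (f : N →ₐ[ℂ] D) (V : D)
    (h₁ : V * V = f A.x * V) (h₂ : f (star A.w) * V = 1) (h₃ : ∀ a, V * f a = f (A.θ a) * V) :
    ∃! F : A.Ext →ₐ[ℂ] D, (∀ a, F (A.ι a) = f a) ∧ F A.v = V := by
  have key : ∀ b : A.Ext, b = A.ι b.coeff * A.v := fun b => (A.ι_mul_v b.coeff).symm
  let L : A.Ext →ₗ[ℂ] D :=
    { toFun := fun b => f b.coeff * V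
      map_add' := fun b c => by simp [add_mul]
      map_smul' := fun z b => by simp }
  refine ⟨AlgHom.ofLinearMap L h₂ ?_, ⟨fun a => ?_, ?_⟩, fun G hG => ?_⟩
  · intro b c
    change f (b.coeff * A.θ c.coeff * A.x) * V = f b.coeff * V * (f c.coeff * V)
    rw [map_mul, map_mul, mul_assoc, ← h₁, mul_assoc (f b.coeff) V, ← mul_assoc V, h₃]
    simp only [mul_assoc]
  · change f (a * star A.w) * V = f a
    rw [map_mul, mul_assoc, h₂, mul_one]
  · change f 1 * V = V
    rw [map_one, one_mul]
  · ext b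
    rw [key b, map_mul, hG.1, hG.2]
    change _ = f (A.ι b.coeff * A.v).coeff * V
    rw [ι_mul_v]

section FreeProduct

variable (A₁ A₂ : QSystem N)

/-- The free product (coproduct of unital `ℂ`-algebras) of the two extensions. -/
abbrev FreeProd : Type u :=
  LinearAlgebra.FreeProduct ℂ (fun i : Fin 2 => (![A₁, A₂] i).Ext)

/-- The canonical map of the first factor into the free product. -/
noncomputable def inl : A₁.Ext →ₐ[ℂ] FreeProd A₁ A₂ :=
  LinearAlgebra.FreeProduct.ι ℂ (fun i : Fin 2 => (![A₁, A₂] i).Ext) 0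

/-- The canonical map of the second factor into the free product. -/
noncomputable def inr : A₂.Ext →ₐ[ℂ] FreeProd A₁ A₂ :=
  LinearAlgebra.FreeProduct.ι ℂ (fun i : Fin 2 => (![A₁, A₂] i).Ext) 1

/-- The relations `ι₁(a) = ι₂(a)` for `a` in `N`, and `v₂ v₁ = e v₁ v₂`. -/
inductive ProdRel (e : N) : FreeProd A₁ A₂ → FreeProd A₁ A₂ → Prop
  | identify (a : N) : ProdRel e (inl A₁ A₂ (A₁.ι a)) (inr A₁ A₂ (A₂.ι a))
  | comm : ProdRel e (inr A₁ A₂ A₂.v * inl A₁ A₂ A₁.v)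
      (inl A₁ A₂ (A₁.ι e) * inl A₁ A₂ A₁.v * inr A₁ A₂ A₂.v)

/-- The quotient of the free product of the two extensions by these relations. -/
abbrev ProdQuot (e : N) : Type u := RingQuot (ProdRel A₁ A₂ e)

/-- The quotient map. -/
noncomputable def toProdQuot (e : N) : FreeProd A₁ A₂ →ₐ[ℂ] ProdQuot A₁ A₂ e :=
  RingQuot.mkAlgHom ℂ (ProdRel A₁ A₂ e)

end FreeProduct

end QSystem

end BraidedProduct

/-! In the extension sought, the generator is `v = v₁v₂`. Moving `v₂` past `v₁` by `v₂v₁ = E v₁v₂`,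
with `E` the braiding, turns `v₁v₂v₁v₂` into `θ₁(E) x₁ θ₁(x₂) v₁v₂`, which explains the formula for
the product. The algebra uses only that `E` is a unitary intertwiner through which `w₁, w₂, x₁, x₂`
slide (`IsExchange`). Naturality and the hexagons give this for `ε⁺`; since the property passes to
adjoints with the factors swapped, it holds for `ε⁻` too.

The analytic point is standardness: the products of `w` and `x` with their adjoints give `d₁d₂`,
which must equal `√dim(θ₁θ₂)`, although `dim` is an infimum over all solutions of the conjugacy
equations. A solution is minimal exactly when its left and right inverses agree. If it is minimal,
differentiating along deformations by `exp(s k)` gives this equality (`spherical`); conversely, the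
equality bounds every competitor from below (`dim_eq_of_spherical`). The equality survives
composition, so `dim` is multiplicative on endomorphisms with minimal solutions (`dim_mul`). For a
Q-system `x w` is such a solution, `θ` being its own conjugate.

Each factor is recovered by compressing the other to its unit, through the isometries `θ₁(w₂)/√d₂`
and `w₁/√d₁`. The same cancellations give the embeddings `j₁, j₂`, with `j₁(v₁) j₂(v₂) = v`. This
identity supplies the inverse of the map from the quotient of the free product: the universal
property of the extension sends `v` to `v₁v₂` (`exists_prodQuot_equiv`). -/

namespace BraidedProduct

universe u

/-! ### Conjugacy equations, minimal solutions and multiplicativity of the dimension. -/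

section Dimension

variable {N : Type u} [CStarAlgebra N]

namespace Hom

variable {φ ψ χ : N →⋆ₐ[ℂ] N} {s t : N}

lemma star_mem (ht : t ∈ Hom φ ψ) : star t ∈ Hom ψ φ := fun a => by
  have h := congrArg star (ht (star a))
  simpa [← map_star] using h.symm

lemma mul_mem (hs : s ∈ Hom ψ χ) (ht : t ∈ Hom φ ψ) : s * t ∈ Hom φ χ := fun a => by
  rw [mul_assoc, ht a, ← mul_assoc, hs a, mul_assoc]

lemma map_mem (χ : N →⋆ₐ[ℂ] N) (ht : t ∈ Hom φ ψ) : χ t ∈ Hom (χ * φ) (χ * ψ) := fun a => by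
  change χ t * χ (φ a) = χ (ψ a) * χ t
  rw [← map_mul, ht a, map_mul]

lemma mul_right_mem (χ : N →⋆ₐ[ℂ] N) (ht : t ∈ Hom φ ψ) : t ∈ Hom (φ * χ) (ψ * χ) :=
  fun a => ht (χ a)

lemma smul_mem (c : ℂ) (ht : t ∈ Hom φ ψ) : c • t ∈ Hom φ ψ := fun a => by
  rw [smul_mul_assoc, ht a, mul_smul_comm]

lemma eq_smul_one [Algebra.IsCentral ℂ N] (ht : t ∈ Hom (1 : N →⋆ₐ[ℂ] N) 1) :
    ∃ c : ℂ, t = c • (1 : N) := by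
  have h : t ∈ Subalgebra.center ℂ N := Subalgebra.mem_center_iff.2 fun a => (ht a).symm
  obtain ⟨c, hc⟩ := (Algebra.IsCentral.mem_center_iff ℂ).1 h
  exact ⟨c, by rw [hc, Algebra.algebraMap_eq_smul_one]⟩

/-- The trivial centre makes `t* t` a scalar; it is real and nonnegative by positivity, and the
C*-identity computes it. -/
lemma star_mul_self_eq [Nontrivial N] [Algebra.IsCentral ℂ N] (ht : t ∈ Hom 1 φ) :
    star t * t = ((‖t‖ ^ 2 : ℝ) : ℂ) • (1 : N) := by
  obtain ⟨c, hc⟩ := eq_smul_one (mul_mem (star_mem ht) ht)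
  have hcr : star c = c := by
    have h := congrArg star hc
    rw [star_mul, star_star, hc, star_smul, star_one] at h
    exact (smul_left_injective ℂ (one_ne_zero (α := N)) h).symm
  obtain ⟨r, rfl⟩ : ∃ r : ℝ, (r : ℂ) = c := Complex.conj_eq_iff_real.1 hcr |>.imp fun _ h => h.symm
  have hr : 0 ≤ r := by
    refine spectrum_star_mul_self_nonneg (b := t) r ?_
    have : star t * t = algebraMap ℝ N r := by
      rw [hc, Algebra.algebraMap_eq_smul_one]; exact (Complex.coe_smul r (1 : N))
    rw [this, spectrum.scalar_eq]
    rfl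
  have hn := congrArg norm hc
  rw [CStarRing.norm_star_mul_self, norm_smul, norm_one, mul_one, Complex.norm_real,
    Real.norm_of_nonneg hr] at hn
  rw [hc, ← hn, sq]

end Hom

lemma norm_sq_of_star_mul_self [Nontrivial N] {t : N} {d : ℝ} (hd : 0 ≤ d)
    (h : star t * t = (d : ℂ) • (1 : N)) : ‖t‖ ^ 2 = d := by
  rw [sq, ← CStarRing.norm_star_mul_self, h, norm_smul, norm_one, mul_one, Complex.norm_real,
    Real.norm_of_nonneg hd]

namespace IsConjugateSolution

variable {φ φ' φ'' : N →⋆ₐ[ℂ] N} {w v w' v' : N} {d d' : ℝ≥0}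

lemma dim_le (h : IsConjugateSolution φ φ' w v d) : dim φ ≤ d := sInf_le ⟨d, φ', w, v, h, rfl⟩

lemma conj_left_star (h : IsConjugateSolution φ φ' w v d) : φ (star w) * v = 1 := by
  simpa [← map_star] using congrArg star h.conj_left

lemma conj_right_star (h : IsConjugateSolution φ φ' w v d) : φ' (star v) * w = 1 := by
  simpa [← map_star] using congrArg star h.conj_right

lemma pos [Nontrivial N] (h : IsConjugateSolution φ φ' w v d) : 0 < d := by
  refine pos_iff_ne_zero.2 fun hd => ?_
  have hw : w = 0 := by
    have := norm_sq_of_star_mul_self d.2 h.norm_w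
    simpa [hd] using this
  simpa [hw] using h.conj_left

/-- A solution can be deformed by an invertible self-adjoint element of `Hom φ' φ'`. -/
lemma dim_le_of_deform [Nontrivial N] [Algebra.IsCentral ℂ N]
    (h : IsConjugateSolution φ φ' w v d) {p q : N} (hp : IsSelfAdjoint p) (hq : IsSelfAdjoint q)
    (hpm : p ∈ Hom φ' φ') (hqm : q ∈ Hom φ' φ') (hqp : q * p = 1) :
    dim φ ≤ ENNReal.ofReal (‖p * w‖ * ‖φ q * v‖) := by
  have hw : p * w ∈ Hom 1 (φ' * φ) := Hom.mul_mem (Hom.mul_right_mem φ hpm) h.w_mem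
  have hv : φ q * v ∈ Hom 1 (φ * φ') := Hom.mul_mem (Hom.map_mem φ hqm) h.v_mem
  have e₁ : star (φ q * v) * φ (p * w) = 1 := by
    rw [star_mul, ← map_star, hq.star_eq, map_mul, mul_assoc, ← mul_assoc (φ q), ← map_mul, hqp,
      map_one, one_mul, h.conj_left]
  have e₂ : star (p * w) * φ' (φ q * v) = 1 := by
    have hw' : star w * φ' (φ q) = q * star w := Hom.star_mem h.w_mem q
    have hpc : p * φ' (φ q * v) = φ' (φ q * v) * p := hpm _
    rw [star_mul, hp.star_eq, mul_assoc, hpc, map_mul, ← mul_assoc, ← mul_assoc, hw', mul_assoc q,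
      h.conj_right, mul_one, hqp]
  have n₁ := Hom.star_mul_self_eq hw
  have n₂ := Hom.star_mul_self_eq hv
  generalize p * w = w' at *
  generalize φ q * v = v' at *
  have hw0 : 0 < ‖w'‖ := norm_pos_iff.2 fun h0 => by simp [h0] at e₁
  have hv0 : 0 < ‖v'‖ := norm_pos_iff.2 fun h0 => by simp [h0] at e₁
  -- Rescaling by `r` and `r⁻¹` keeps the conjugacy equations; this `r` makes both normalizations
  -- equal to `‖w'‖ ‖v'‖`.
  obtain ⟨r, hr0, hr⟩ : ∃ r : ℝ, 0 < r ∧ r ^ 2 = ‖v'‖ / ‖w'‖ :=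
    ⟨√(‖v'‖ / ‖w'‖), Real.sqrt_pos.2 (by positivity), Real.sq_sqrt (by positivity)⟩
  have hrc : (r : ℂ) ≠ 0 := Complex.ofReal_ne_zero.2 hr0.ne'
  have hsol : IsConjugateSolution φ φ' ((r : ℂ) • w') (((r⁻¹ : ℝ) : ℂ) • v')
      (Real.toNNReal (‖w'‖ * ‖v'‖)) := by
    refine ⟨Hom.smul_mem _ hw, Hom.smul_mem _ hv, ?_, ?_, ?_, ?_⟩
    · rw [star_smul, map_smul, smul_mul_smul_comm, e₁]
      simp [hrc]
    · rw [star_smul, map_smul, smul_mul_smul_comm, e₂]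
      simp [hrc]
    · rw [star_smul, smul_mul_smul_comm, n₁, smul_smul, Real.coe_toNNReal _ (by positivity),
        Complex.star_def, Complex.conj_ofReal, ← Complex.ofReal_mul, ← Complex.ofReal_mul]
      congr 2
      rw [← sq, hr]; field_simp
    · rw [star_smul, smul_mul_smul_comm, n₂, smul_smul, Real.coe_toNNReal _ (by positivity),
        Complex.star_def, Complex.conj_ofReal, ← Complex.ofReal_mul, ← Complex.ofReal_mul]
      congr 2
      rw [← mul_inv, ← sq, hr]; field_simp
  exact hsol.dim_le

/-- The left and right inverses given by a solution of minimal normalization agree on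
`Hom φ' φ'`. -/
lemma spherical [Nontrivial N] [Algebra.IsCentral ℂ N] (h : IsConjugateSolution φ φ' w v d)
    (hd : dim φ = d) {k : N} (hk : IsSelfAdjoint k) (hkm : k ∈ Hom φ' φ') :
    star w * k * w = star v * φ k * v := by
  let _ : NormedAlgebra ℚ N := NormedAlgebra.restrictScalars ℚ ℝ N
  obtain ⟨c₁, hc₁⟩ := Hom.eq_smul_one
    (Hom.mul_mem (Hom.mul_mem (Hom.star_mem h.w_mem) (Hom.mul_right_mem φ hkm)) h.w_mem)
  obtain ⟨c₂, hc₂⟩ := Hom.eq_smul_one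
    (Hom.mul_mem (Hom.mul_mem (Hom.star_mem h.v_mem) (Hom.map_mem φ hkm)) h.v_mem)
  have real_of (c : ℂ) (z : N) (hz : IsSelfAdjoint z) (hc : z = c • (1 : N)) : (c.re : ℂ) = c := by
    have h := hz.star_eq
    rw [hc, star_smul, star_one] at h
    exact Complex.conj_eq_iff_re.1 (smul_left_injective ℂ (one_ne_zero (α := N)) h)
  have hr₁ := real_of c₁ _ (by simpa using hk.conjugate' w) hc₁
  have hr₂ := real_of c₂ _ (by simpa using (hk.map φ).conjugate' v) hc₂
  -- The values compared are scalar multiples of `1`; a functional with `g 1 = 1` turns them into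
  -- numbers that can be differentiated.
  obtain ⟨g, -, hg⟩ := exists_dual_vector ℂ (1 : N) (by simp)
  replace hg : g 1 = 1 := by simpa using hg
  let W : N →L[ℝ] ℝ := Complex.reCLM.comp ((g.restrictScalars ℝ).comp
    ((ContinuousLinearMap.mul ℝ N (star w)).comp ((ContinuousLinearMap.mul ℝ N).flip w)))
  let φL : N →L[ℂ] N := ⟨φ.toAlgHom.toLinearMap,
    AddMonoidHomClass.continuous_of_bound φ 1 fun x => by
      simpa using NonUnitalStarAlgHom.norm_apply_le φ x⟩
  let V : N →L[ℝ] ℝ := Complex.reCLM.comp ((g.restrictScalars ℝ).comp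
    ((ContinuousLinearMap.mul ℝ N (star v)).comp
      (((ContinuousLinearMap.mul ℝ N).flip v).comp (φL.restrictScalars ℝ))))
  have hW (z : N) : W z = (g (star w * (z * w))).re := rfl
  have hV (z : N) : V z = (g (star v * (φ z * v))).re := rfl
  let e (s : ℝ) : N := NormedSpace.exp (s • k)
  have he (s t : ℝ) : e (s + t) = e s * e t := by
    simp only [e, add_smul]
    exact NormedSpace.exp_add_of_commute (((Commute.refl k).smul_left s).smul_right t)
  have he0 : e 0 = 1 := by simp [e]
  have hes (s : ℝ) : IsSelfAdjoint (e s) := ((IsSelfAdjoint.all s).smul hk).exp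
  have hem (s : ℝ) : e s ∈ Hom φ' φ' := fun a =>
    (Commute.exp_left (show Commute (s • k) (φ' a) from Commute.smul_left (hkm a) s))
  have hW2 (s : ℝ) : W (e s) = ‖e (s / 2) * w‖ ^ 2 := by
    have h1 := Hom.star_mul_self_eq (Hom.mul_mem (Hom.mul_right_mem φ (hem (s / 2))) h.w_mem)
    rw [star_mul, (hes _).star_eq, mul_assoc, ← mul_assoc (e _), ← he, add_halves] at h1
    rw [hW, h1, map_smul, hg, smul_eq_mul, mul_one, Complex.ofReal_re]
  have hV2 (s : ℝ) : V (e s) = ‖φ (e (s / 2)) * v‖ ^ 2 := by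
    have h1 := Hom.star_mul_self_eq (Hom.mul_mem (Hom.map_mem φ (hem (s / 2))) h.v_mem)
    rw [star_mul, ← map_star, (hes _).star_eq, mul_assoc, ← mul_assoc (φ _), ← map_mul, ← he,
      add_halves] at h1
    rw [hV, h1, map_smul, hg, smul_eq_mul, mul_one, Complex.ofReal_re]
  have hW0 : W (e 0) = d := by rw [he0, hW, one_mul, h.norm_w, map_smul, hg]; simp
  have hV0 : V (e 0) = d := by rw [he0, hV, map_one, one_mul, h.norm_v, map_smul, hg]; simp
  -- The left side is `d²`. The right side is the square of the normalization obtained by deforming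
  -- with `exp(s k/2)` and its inverse, so minimality of `d` gives the bound.
  have hmin (s : ℝ) : W (e 0) * V (e (-0)) ≤ W (e s) * V (e (-s)) := by
    rw [neg_zero, hW0, hV0, hW2, hV2, ← mul_pow, ← sq]
    refine pow_le_pow_left₀ d.2 ?_ 2
    have := h.dim_le_of_deform (hes (s / 2)) (hes (-s / 2)) (hem _) (hem _)
      (by rw [← he, ← add_div, neg_add_cancel, zero_div, he0])
    rw [hd, ← ENNReal.ofReal_coe_nnreal] at this
    exact (ENNReal.ofReal_le_ofReal_iff (by positivity)).1 this
  have de : HasDerivAt e k 0 := by simpa [e] using hasDerivAt_exp_smul_const k (0 : ℝ)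
  have de' : HasDerivAt (fun s => e (-s)) (-k) 0 := by
    have := HasDerivAt.scomp (0 : ℝ) (by simpa using de : HasDerivAt e k (-0)) (hasDerivAt_neg 0)
    simpa [Function.comp_def] using this
  have dW : HasDerivAt (fun s => W (e s)) (W k) 0 := W.hasFDerivAt.comp_hasDerivAt 0 de
  have dV : HasDerivAt (fun s => V (e (-s))) (V (-k)) 0 := V.hasFDerivAt.comp_hasDerivAt 0 de'
  -- The derivative at the minimum is `W k * d - d * V k`, and `d ≠ 0`.
  have key := IsLocalMin.hasDerivAt_eq_zero (Filter.Eventually.of_forall hmin) (dW.mul dV)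
  rw [neg_zero, hW0, hV0, map_neg] at key
  have hd0 : (d : ℝ) ≠ 0 := NNReal.coe_ne_zero.2 h.pos.ne'
  have hWV : W k = V k := mul_right_cancel₀ hd0 (by linarith)
  rw [hW, hV, ← mul_assoc, ← mul_assoc, hc₁, hc₂, map_smul, map_smul, hg] at hWV
  rw [hc₁, hc₂, ← hr₁, ← hr₂]
  simp only [smul_eq_mul, mul_one] at hWV
  rw [hWV]

/-- A solution whose left and right inverses agree has minimal normalization. -/
lemma dim_eq_of_spherical [Nontrivial N] (h : IsConjugateSolution φ φ' w v d)
    (hs : ∀ k, IsSelfAdjoint k → k ∈ Hom φ' φ' → star w * k * w = star v * φ k * v) :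
    dim φ = d := by
  refine le_antisymm h.dim_le (le_sInf ?_)
  rintro _ ⟨d', φ'', w', v', h', rfl⟩
  rw [ENNReal.coe_le_coe, ← NNReal.coe_le_coe]
  -- Conjugates are unique up to an invertible intertwiner: `p` and `q` compare the two conjugates
  -- and carry the given solution to the competitor.
  set p := φ'' (star v) * w' with hp
  set q := φ' (star v') * w with hq
  have hwc (a : N) : w * a = φ' (φ a) * w := h.w_mem a
  have hvc (a : N) : v * a = φ (φ' a) * v := h.v_mem a
  have hwc' (a : N) : w' * a = φ'' (φ a) * w' := h'.w_mem a
  have hvc' (a : N) : star v' * φ (φ'' a) = a * star v' := Hom.star_mem h'.v_mem a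
  have hpw : p * w = w' := by
    rw [hp, mul_assoc, hwc', ← mul_assoc, ← map_mul, h.conj_left, map_one, one_mul]
  have hqv : φ (star q) * v = v' := by
    rw [hq, star_mul, ← map_star, star_star, map_mul, mul_assoc, ← hvc, ← mul_assoc,
      h.conj_left_star, one_mul]
  have hqp : q * p = 1 := by
    rw [hp, hq, mul_assoc, hwc, ← mul_assoc, ← map_mul, map_mul φ, ← mul_assoc, hvc', mul_assoc,
      h'.conj_left, mul_one, h.conj_right_star]
  have hqm : q ∈ Hom φ'' φ' := fun a => by
    rw [hq, mul_assoc, hwc, ← mul_assoc, ← map_mul, hvc', map_mul, mul_assoc]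
  -- Here the hypothesis enters: for `q q*` the left inverse may be replaced by the right one, which
  -- is the competitor's `v'* v'`.
  have hn : star (star q * w) * (star q * w) = (d' : ℂ) • (1 : N) := by
    rw [star_mul, star_star, mul_assoc, ← mul_assoc q, ← mul_assoc,
      hs (q * star q) (IsSelfAdjoint.mul_star_self q) (Hom.mul_mem hqm (Hom.star_mem hqm))]
    have h1 := h'.norm_v
    rw [← hqv, star_mul, ← map_star, star_star] at h1
    rw [map_mul, ← mul_assoc, mul_assoc, h1]
  have hd : star (p * w) * (star q * w) = (d : ℂ) • (1 : N) := by
    rw [star_mul, mul_assoc, ← mul_assoc (star p), ← star_mul, hqp, star_one, one_mul, h.norm_w]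
  have n₁ := norm_sq_of_star_mul_self d'.coe_nonneg hn
  have n₂ := norm_sq_of_star_mul_self d'.coe_nonneg h'.norm_w
  have n₃ := congrArg norm hd
  rw [norm_smul, norm_one, mul_one, Complex.norm_real,
    Real.norm_of_nonneg d.coe_nonneg, hpw] at n₃
  -- Since `q p = 1`, `d` is the norm of `(p w)* (q* w)`; both factors have norm `√d'`, whence `d ≤
  -- d'`.
  have n₄ : (d : ℝ) ≤ ‖w'‖ * ‖star q * w‖ := by
    have := norm_mul_le (star w') (star q * w)
    rw [n₃, norm_star] at this
    exact this
  nlinarith [sq_nonneg (‖w'‖ - ‖star q * w‖)]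

/-- The arcs of one solution are nested inside those of the other, so the zigzags straighten one
after the other and the normalizations multiply. -/
lemma mul {ψ ψ' : N →⋆ₐ[ℂ] N} {x y : N} {c : ℝ≥0} (h : IsConjugateSolution φ φ' w v d)
    (h' : IsConjugateSolution ψ ψ' x y c) :
    IsConjugateSolution (φ * ψ) (ψ' * φ') (ψ' w * x) (φ y * v) (d * c) where
  w_mem a := by
    have e₁ := h.w_mem (ψ a)
    have e₂ := h'.w_mem a
    change w * ψ a = φ' (φ (ψ a)) * w at e₁
    change x * a = ψ' (ψ a) * x at e₂
    change ψ' w * x * a = ψ' (φ' (φ (ψ a))) * (ψ' w * x)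
    rw [mul_assoc, e₂, ← mul_assoc, ← mul_assoc, ← map_mul, ← map_mul, e₁]
  v_mem a := by
    have e₁ := h'.v_mem (φ' a)
    have e₂ := h.v_mem a
    change y * φ' a = ψ (ψ' (φ' a)) * y at e₁
    change v * a = φ (φ' a) * v at e₂
    change φ y * v * a = φ (ψ (ψ' (φ' a))) * (φ y * v)
    rw [mul_assoc, e₂, ← mul_assoc, ← mul_assoc, ← map_mul, ← map_mul, e₁]
  conj_left := by
    have e₁ : star y * ψ (ψ' w) = w * star y := Hom.star_mem h'.v_mem w
    change star (φ y * v) * φ (ψ (ψ' w * x)) = 1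
    rw [star_mul, ← map_star, mul_assoc, ← map_mul, map_mul ψ, ← mul_assoc (star y), e₁, mul_assoc,
      h'.conj_left, mul_one, h.conj_left]
  conj_right := by
    have e₁ : star w * φ' (φ y) = y * star w := Hom.star_mem h.w_mem y
    change star (ψ' w * x) * ψ' (φ' (φ y * v)) = 1
    rw [star_mul, ← map_star, mul_assoc, ← map_mul, map_mul φ', ← mul_assoc (star w), e₁, mul_assoc,
      h.conj_right, mul_one, h'.conj_right]
  norm_w := by
    rw [star_mul, mul_assoc, ← mul_assoc (star (ψ' w)), ← map_star, ← map_mul, h.norm_w, map_smul,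
      map_one, smul_mul_assoc, one_mul, mul_smul_comm, h'.norm_w, smul_smul]
    push_cast; rfl
  norm_v := by
    rw [star_mul, mul_assoc, ← mul_assoc (star (φ y)), ← map_star, ← map_mul, h'.norm_v, map_smul,
      map_one, smul_mul_assoc, one_mul, mul_smul_comm, h.norm_v, smul_smul, mul_comm (_ : ℂ)]
    push_cast; rfl

/-- The dimension is multiplicative on endomorphisms with solutions of minimal normalization. -/
lemma dim_mul [Nontrivial N] [Algebra.IsCentral ℂ N] {ψ ψ' : N →⋆ₐ[ℂ] N} {x y : N} {c : ℝ≥0}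
    (h : IsConjugateSolution φ φ' w v d) (hd : dim φ = d)
    (h' : IsConjugateSolution ψ ψ' x y c) (hc : dim ψ = c) :
    dim (φ * ψ) = dim φ * dim ψ := by
  rw [(h.mul h').dim_eq_of_spherical, hd, hc, ENNReal.coe_mul]
  intro k hk hkm
  have hψw : ψ' w ∈ Hom ψ' (ψ' * φ' * φ) := Hom.map_mem ψ' h.w_mem
  -- Closing only the `φ'` strand of `k` by `w` leaves an element of `Hom ψ' ψ'`; sphericality of
  -- the second solution applies to it.
  have e₁ := h'.spherical hc (k := star (ψ' w) * k * ψ' w) (hk.conjugate' _)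
    (Hom.mul_mem (Hom.mul_mem (Hom.star_mem hψw) (Hom.mul_right_mem φ hkm)) hψw)
  have hy : y ∈ Hom φ' (ψ * (ψ' * φ')) := Hom.mul_right_mem φ' h'.v_mem
  -- Closing the `ψ'` strand on its other side by `y` leaves an element of `Hom φ' φ'`, for the
  -- first solution.
  have e₂ := h.spherical hd (k := star y * ψ k * y) ((hk.map ψ).conjugate' _)
    (Hom.mul_mem (Hom.mul_mem (Hom.star_mem hy) (Hom.map_mem ψ hkm)) hy)
  have e₃ : y * w = ψ (ψ' w) * y := h'.v_mem w
  have e₄ : star y * ψ (star (ψ' w)) = star w * star y := by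
    simpa [← map_star] using congrArg star e₃.symm
  calc star (ψ' w * x) * k * (ψ' w * x)
      = star x * (star (ψ' w) * k * ψ' w) * x := by simp only [star_mul, mul_assoc]
    _ = star y * ψ (star (ψ' w)) * ψ k * (ψ (ψ' w) * y) := by
        rw [e₁]; simp only [map_mul, mul_assoc]
    _ = star w * (star y * ψ k * y) * w := by rw [e₄, ← e₃]; simp only [mul_assoc]
    _ = star v * φ (star y * ψ k * y) * v := e₂
    _ = star (φ y * v) * φ (ψ k) * (φ y * v) := by
        simp only [star_mul, map_mul, map_star, mul_assoc]

end IsConjugateSolution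

end Dimension

/-! ### Q-systems as minimal self-conjugate solutions. -/

namespace QSystem

variable {N : Type u} [CStarAlgebra N]

lemma star_x_mul_θ_w (A : QSystem N) : star A.x * A.θ A.w = 1 := by
  simpa [← map_star] using congrArg star A.unit_right

lemma dim_eq_coe (A : QSystem N) : dim A.θ = (dim A.θ).toNNReal :=
  (ENNReal.coe_toNNReal A.dim_ne_top).symm

lemma d_nonneg (A : QSystem N) : 0 ≤ A.d := Real.sqrt_nonneg _

lemma star_w_mul_w (A : QSystem N) : star A.w * A.w = (A.d : ℂ) • (1 : N) := A.standard_w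

lemma star_x_mul_x (A : QSystem N) : star A.x * A.x = (A.d : ℂ) • (1 : N) := A.standard_x

lemma d_pos [Nontrivial N] (A : QSystem N) : 0 < A.d := by
  refine A.d_nonneg.lt_of_ne fun h => ?_
  have h1 := norm_sq_of_star_mul_self A.d_nonneg A.star_w_mul_w
  have h2 : A.w = 0 := by simpa [← h] using h1
  simpa [h2] using A.unit_left

/-- The multiplication of a Q-system, applied to its unit, makes `θ` self-conjugate. -/
lemma isConjugateSolution (A : QSystem N) :
    IsConjugateSolution A.θ A.θ (A.x * A.w) (A.x * A.w) (dim A.θ).toNNReal := by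
  have hm : A.x * A.w ∈ Hom 1 (A.θ * A.θ) := Hom.mul_mem A.x_mem A.w_mem
  have hf : star A.x * A.θ A.x = A.x * star A.x := by
    simpa [← map_star] using (congrArg star A.frobenius).symm
  have hc : star (A.x * A.w) * A.θ (A.x * A.w) = 1 := by
    rw [star_mul, map_mul, mul_assoc, ← mul_assoc (star A.x), hf, mul_assoc, star_x_mul_θ_w,
      mul_one, A.unit_left]
  have hn : star (A.x * A.w) * (A.x * A.w) =
      (((dim A.θ).toNNReal : ℝ) : ℂ) • (1 : N) := by
    rw [star_mul, mul_assoc, ← mul_assoc (star A.x), star_x_mul_x, smul_mul_assoc, one_mul,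
      mul_smul_comm, star_w_mul_w, smul_smul, ← Complex.ofReal_mul]
    congr 2
    exact Real.mul_self_sqrt ENNReal.toReal_nonneg
  exact ⟨hm, hm, hc, hc, hn, hn⟩

lemma dim_mul [Nontrivial N] [Algebra.IsCentral ℂ N] (A₁ A₂ : QSystem N) :
    dim (A₁.θ * A₂.θ) = dim A₁.θ * dim A₂.θ :=
  A₁.isConjugateSolution.dim_mul A₁.dim_eq_coe A₂.isConjugateSolution A₂.dim_eq_coe

end QSystem

/-! ### Exchange unitaries from a braiding. -/

variable {N : Type u} [CStarAlgebra N]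

/-- A unitary `E : θ₁ θ₂ → θ₂ θ₁` that is natural with respect to the structure maps of two
Q-systems: this is the part of a braiding that the braided product uses. -/
structure IsExchange (A₁ A₂ : QSystem N) (E : N) : Prop where
  mem_unitary : E ∈ unitary N
  mem_Hom : E ∈ Hom (A₁.θ * A₂.θ) (A₂.θ * A₁.θ)
  mul_w₁ : E * A₁.w = A₂.θ A₁.w
  mul_w₂ : E * A₁.θ A₂.w = A₂.w
  mul_x₁ : E * A₁.θ E * A₁.x = A₂.θ A₁.x * E
  mul_x₂ : A₂.θ E * E * A₁.θ A₂.x = A₂.x * E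

namespace BraidedCat

variable (C : BraidedCat N)

lemma star_ε_mul_ε (ρ σ : C.obj) : star (C.ε ρ σ) * C.ε ρ σ = 1 := (C.ε_unitary ρ σ).1

/-- The hexagon at two identity objects makes this unitary idempotent. -/
lemma ε_one_left (σ : C.obj) : C.ε 1 σ = 1 := by
  have h := C.hexagon_left 1 1 σ
  rw [mul_one] at h
  have h' : C.ε 1 σ = C.ε 1 σ * C.ε 1 σ := h
  have := congrArg (star (C.ε 1 σ) * ·) h'
  simpa only [← mul_assoc, star_ε_mul_ε, one_mul] using this.symm

lemma ε_one_right (ρ : C.obj) : C.ε ρ 1 = 1 := by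
  have h := C.hexagon_right ρ 1 1
  rw [mul_one] at h
  have h' : C.ε ρ 1 = C.ε ρ 1 * C.ε ρ 1 := h
  have := congrArg (star (C.ε ρ 1) * ·) h'
  simpa only [← mul_assoc, star_ε_mul_ε, one_mul] using this.symm

lemma isExchange_plus (A₁ A₂ : QSystem N) (h₁ : A₁.θ ∈ C.obj) (h₂ : A₂.θ ∈ C.obj) :
    IsExchange A₁ A₂ (C.ε ⟨A₁.θ, h₁⟩ ⟨A₂.θ, h₂⟩) where
  mem_unitary := C.ε_unitary _ _
  mem_Hom := C.ε_mem _ _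
  mul_w₁ := by
    have := C.natural_left 1 ⟨A₁.θ, h₁⟩ ⟨A₂.θ, h₂⟩ A₁.w A₁.w_mem
    rwa [ε_one_left, mul_one] at this
  mul_w₂ := by
    have := C.natural_right ⟨A₁.θ, h₁⟩ 1 ⟨A₂.θ, h₂⟩ A₂.w A₂.w_mem
    rwa [ε_one_right, mul_one] at this
  mul_x₁ := by
    have := C.natural_left ⟨A₁.θ, h₁⟩ (⟨A₁.θ, h₁⟩ * ⟨A₁.θ, h₁⟩) ⟨A₂.θ, h₂⟩ A₁.x A₁.x_mem
    rwa [hexagon_left] at this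
  mul_x₂ := by
    have := C.natural_right ⟨A₁.θ, h₁⟩ ⟨A₂.θ, h₂⟩ (⟨A₂.θ, h₂⟩ * ⟨A₂.θ, h₂⟩) A₂.x A₂.x_mem
    rwa [hexagon_right] at this

end BraidedCat

namespace IsExchange

variable {A₁ A₂ : QSystem N} {E : N}

lemma star_mul_self (h : IsExchange A₁ A₂ E) : star E * E = 1 := h.mem_unitary.1

lemma mul_star_self (h : IsExchange A₁ A₂ E) : E * star E = 1 := h.mem_unitary.2

/-- The adjoint of an exchange is an exchange in the opposite direction. -/
lemma symm (h : IsExchange A₁ A₂ E) : IsExchange A₂ A₁ (star E) where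
  mem_unitary := Unitary.star_mem h.mem_unitary
  mem_Hom := Hom.star_mem h.mem_Hom
  mul_w₁ := by
    have e : star E * (E * A₁.θ A₂.w) = A₁.θ A₂.w := by rw [← mul_assoc, h.star_mul_self, one_mul]
    rwa [h.mul_w₂] at e
  mul_w₂ := by rw [← h.mul_w₁, ← mul_assoc, h.star_mul_self, one_mul]
  mul_x₁ := by
    have e : star E * A₂.θ (star E) * (A₂.θ E * E * A₁.θ A₂.x) * star E =
        star E * A₂.θ (star E) * A₂.x := by
      rw [h.mul_x₂, mul_assoc, mul_assoc A₂.x, h.mul_star_self, mul_one]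
    have e' : A₂.θ (star E) * A₂.θ E = 1 := by rw [← map_mul, h.star_mul_self, map_one]
    rw [← e]
    simp only [mul_assoc]
    rw [← mul_assoc (A₂.θ (star E)), e', one_mul, ← mul_assoc (star E) E, h.star_mul_self, one_mul]
  mul_x₂ := by
    have e : A₁.θ (star E) * star E * (E * A₁.θ E * A₁.x) * star E =
        A₁.θ (star E) * star E * A₂.θ A₁.x := by
      rw [h.mul_x₁, mul_assoc, mul_assoc (A₂.θ A₁.x), h.mul_star_self, mul_one]
    have e' : A₁.θ (star E) * A₁.θ E = 1 := by rw [← map_mul, h.star_mul_self, map_one]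
    rw [← e]
    simp only [mul_assoc]
    rw [← mul_assoc (star E) E, h.star_mul_self, one_mul, ← mul_assoc (A₁.θ (star E)), e', one_mul]

/-- This and the next two rules move `w₂*`, `w₁*` and `x₁*` across `E`; they are adjoints of the
relations for `star E`. -/
lemma star_w₂_mul (h : IsExchange A₁ A₂ E) : star A₂.w * E = A₁.θ (star A₂.w) := by
  have := congrArg star h.symm.mul_w₁
  simpa [← map_star] using this

lemma θ_star_w₁_mul (h : IsExchange A₁ A₂ E) : A₂.θ (star A₁.w) * E = star A₁.w := by
  have := congrArg star h.symm.mul_w₂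
  simpa [← map_star] using this

lemma θ_star_x₁_mul (h : IsExchange A₁ A₂ E) :
    A₂.θ (star A₁.x) * E * A₁.θ E = E * star A₁.x := by
  have := congrArg star h.symm.mul_x₂
  simpa [← map_star, mul_assoc] using this

lemma comm (h : IsExchange A₁ A₂ E) (a : N) : A₂.θ (A₁.θ a) * E = E * A₁.θ (A₂.θ a) :=
  (h.mem_Hom a).symm

end IsExchange

namespace BraidedCat

/-- The opposite braiding is the adjoint of the braiding with the factors interchanged, so
`IsExchange.symm` covers the minus sign. -/
lemma isExchange (C : BraidedCat N) (A₁ A₂ : QSystem N) (h₁ : A₁.θ ∈ C.obj) (h₂ : A₂.θ ∈ C.obj)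
    (pm : Sign) : IsExchange A₁ A₂ (C.braiding pm ⟨A₁.θ, h₁⟩ ⟨A₂.θ, h₂⟩) := by
  cases pm
  · exact C.isExchange_plus A₁ A₂ h₁ h₂
  · exact (C.isExchange_plus A₂ A₁ h₂ h₁).symm

end BraidedCat

/-! ### The braided product is a Q-system. -/

namespace QSystem

open Ext

variable [Nontrivial N] [Algebra.IsCentral ℂ N]

lemma sqrt_dim_mul (A₁ A₂ : QSystem N) : √(dim (A₁.θ * A₂.θ)).toReal = A₁.d * A₂.d := by
  rw [dim_mul, ENNReal.toReal_mul, Real.sqrt_mul ENNReal.toReal_nonneg]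
  rfl

/-- The braided product of two Q-systems, with respect to the exchange `E`. -/
@[simps]
def prod (A₁ A₂ : QSystem N) (E : N) (h : IsExchange A₁ A₂ E) : QSystem N where
  θ := A₁.θ * A₂.θ
  w := A₁.θ A₂.w * A₁.w
  x := A₁.θ E * A₁.x * A₁.θ A₂.x
  dim_ne_top := by
    rw [dim_mul]
    exact ENNReal.mul_ne_top A₁.dim_ne_top A₂.dim_ne_top
  w_mem a := by
    change _ = A₁.θ (A₂.θ a) * _
    rw [mul_assoc, w_comm, ← mul_assoc, ← map_mul, w_comm, map_mul, mul_assoc]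
    rfl
  x_mem a := by
    change _ * A₁.θ (A₂.θ a) = A₁.θ (A₂.θ (A₁.θ (A₂.θ a))) * _
    rw [mul_assoc, ← map_mul, x_comm, map_mul, ← mul_assoc, mul_assoc (A₁.θ E), x_comm, ← mul_assoc,
      ← map_mul, ← h.comm, map_mul]
    simp only [mul_assoc]
  unit_left := by
    rw [star_mul, ← map_star]
    calc star A₁.w * A₁.θ (star A₂.w) * (A₁.θ E * A₁.x * A₁.θ A₂.x)
        = star A₁.w * A₁.θ (star A₂.w * E) * A₁.x * A₁.θ A₂.x := by
          simp only [map_mul, mul_assoc]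
      _ = star A₁.w * (A₁.x * A₁.θ (star A₂.w)) * A₁.θ A₂.x := by
          rw [h.star_w₂_mul, x_comm]; simp only [mul_assoc]
      _ = A₁.θ (star A₂.w * A₂.x) := by
          rw [← mul_assoc, A₁.unit_left, one_mul, map_mul]
      _ = 1 := by rw [A₂.unit_left, map_one]
  unit_right := by
    rw [star_mul, ← map_star]
    change A₁.θ (A₂.θ _) * _ = _
    calc A₁.θ (A₂.θ (star A₁.w * A₁.θ (star A₂.w))) * (A₁.θ E * A₁.x * A₁.θ A₂.x)
        = A₁.θ (A₂.θ (star A₁.w) * (A₂.θ (A₁.θ (star A₂.w)) * E)) * A₁.x * A₁.θ A₂.x := by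
          simp only [map_mul, mul_assoc]
      _ = A₁.θ (A₂.θ (star A₁.w) * E) * (A₁.θ (A₁.θ (A₂.θ (star A₂.w))) * A₁.x) * A₁.θ A₂.x := by
          rw [h.comm]; simp only [map_mul, mul_assoc]
      _ = A₁.θ (star A₁.w) * A₁.x * A₁.θ (A₂.θ (star A₂.w) * A₂.x) := by
          rw [h.θ_star_w₁_mul, ← x_comm]; simp only [map_mul, mul_assoc]
      _ = 1 := by rw [A₁.unit_right, A₂.unit_right, map_one, one_mul]
  assoc := by
    change _ = A₁.θ (A₂.θ _) * _
    -- Both sides of associativity are brought to a form with all crossings on the left; `e₁` does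
    -- this for `x x` and `e₂` for `θ(x) x`. What remains is associativity of the two factors.
    have e₁ : A₁.x * A₁.θ (A₂.θ E * E * A₁.θ A₂.x) * A₁.x =
        A₁.θ (A₁.θ (A₂.θ E * E)) * (A₁.x * A₁.x) * A₁.θ A₂.x := by
      rw [x_comm, map_mul, map_mul, mul_assoc, mul_assoc, ← mul_assoc (A₁.θ (A₁.θ (A₁.θ _))),
        ← x_comm, mul_assoc A₁.x, ← x_comm]
      simp only [mul_assoc]
    have e₂ : A₂.θ (A₁.θ E * A₁.x * A₁.θ A₂.x) * E =
        E * A₁.θ (A₂.θ E * E) * A₁.x * A₁.θ (A₂.θ A₂.x) := by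
      calc A₂.θ (A₁.θ E * A₁.x * A₁.θ A₂.x) * E
          = A₂.θ (A₁.θ E) * A₂.θ A₁.x * (A₂.θ (A₁.θ A₂.x) * E) := by
            simp only [map_mul, mul_assoc]
        _ = A₂.θ (A₁.θ E) * (A₂.θ A₁.x * E) * A₁.θ (A₂.θ A₂.x) := by
            rw [h.comm]; simp only [mul_assoc]
        _ = A₂.θ (A₁.θ E) * E * A₁.θ E * A₁.x * A₁.θ (A₂.θ A₂.x) := by
            rw [← h.mul_x₁]; simp only [mul_assoc]
        _ = _ := by rw [h.comm]; simp only [map_mul, mul_assoc]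
    calc A₁.θ E * A₁.x * A₁.θ A₂.x * (A₁.θ E * A₁.x * A₁.θ A₂.x)
        = A₁.θ E * (A₁.x * A₁.θ (A₂.x * E) * A₁.x) * A₁.θ A₂.x := by
          simp only [map_mul, mul_assoc]
      _ = A₁.θ (E * A₁.θ (A₂.θ E * E)) * (A₁.x * A₁.x) * A₁.θ (A₂.x * A₂.x) := by
          rw [← h.mul_x₂, e₁]; simp only [map_mul, mul_assoc]
      _ = A₁.θ (E * A₁.θ (A₂.θ E * E) * A₁.x) * (A₁.x * A₁.θ (A₂.θ A₂.x)) * A₁.θ A₂.x := by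
          rw [A₁.assoc, A₂.assoc]; simp only [map_mul, mul_assoc]
      _ = A₁.θ (E * A₁.θ (A₂.θ E * E) * A₁.x * A₁.θ (A₂.θ A₂.x)) * A₁.x * A₁.θ A₂.x := by
          rw [x_comm]; simp only [map_mul, mul_assoc]
      _ = _ := by rw [← e₂]; simp only [map_mul, mul_assoc]
  frobenius := by
    simp only [star_mul, ← map_star]
    change _ = A₁.θ (A₂.θ _) * _
    have e : star E * A₂.θ (star E) * A₂.x = A₁.θ A₂.x * star E := h.symm.mul_x₁
    calc A₁.θ E * A₁.x * A₁.θ A₂.x * (A₁.θ (star A₂.x) * (star A₁.x * A₁.θ (star E)))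
        = A₁.θ E * A₁.x * A₁.θ (A₂.x * star A₂.x) * star A₁.x * A₁.θ (star E) := by
          simp only [map_mul, mul_assoc]
      _ = A₁.θ E * (A₁.x * A₁.θ (A₂.θ (star A₂.x))) * (A₁.θ A₂.x * star A₁.x) *
            A₁.θ (star E) := by
          rw [A₂.frobenius]; simp only [map_mul, mul_assoc]
      _ = A₁.θ (E * A₁.θ (A₂.θ (star A₂.x))) * (A₁.x * star A₁.x) *
            A₁.θ (A₁.θ A₂.x * star E) := by
          rw [x_comm, ← star_x_comm]; simp only [map_mul, mul_assoc]
      _ = A₁.θ (E * A₁.θ (A₂.θ (star A₂.x)) * star A₁.x) *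
            (A₁.x * A₁.θ (A₁.θ A₂.x * star E)) := by
          rw [A₁.frobenius]; simp only [map_mul, mul_assoc]
      _ = A₁.θ (A₂.θ (A₁.θ (star A₂.x)) * E * star A₁.x * A₁.θ (star E * A₂.θ (star E) * A₂.x)) *
            A₁.x := by
          rw [x_comm, ← e, h.comm]; simp only [map_mul, mul_assoc]
      -- Sliding `x₁*` through `E` creates a second crossing `θ₁(E)`, which cancels against the
      -- `star E` beside it.
      _ = A₁.θ (A₂.θ (A₁.θ (star A₂.x)) * A₂.θ (star A₁.x) * E * (A₁.θ (E * star E)) *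
            A₁.θ (A₂.θ (star E)) * A₁.θ A₂.x) * A₁.x := by
          rw [mul_assoc _ E, ← h.θ_star_x₁_mul]; simp only [map_mul, mul_assoc]
      _ = A₁.θ (A₂.θ (A₁.θ (star A₂.x)) * A₂.θ (star A₁.x) * (A₂.θ (A₁.θ (star E)) * E)) *
            (A₁.θ (A₁.θ A₂.x) * A₁.x) := by
          rw [h.mul_star_self, h.comm, map_one, mul_one]; simp only [map_mul, mul_assoc]
      _ = _ := by rw [← x_comm]; simp only [map_mul, mul_assoc]
  standard_w := by
    -- Multiplicativity of the dimension identifies the required normalization with `d₁ d₂`.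
    rw [sqrt_dim_mul, star_mul, mul_assoc, ← mul_assoc (star (A₁.θ _)), ← map_star, ← map_mul,
      star_w_mul_w, map_smul, map_one, smul_mul_assoc, one_mul, mul_smul_comm, star_w_mul_w,
      smul_smul, mul_comm A₁.d]
    push_cast; rfl
  standard_x := by
    have e : A₁.θ (star E) * A₁.θ E = 1 := by rw [← map_mul, h.star_mul_self, map_one]
    simp only [star_mul, ← map_star]
    calc A₁.θ (star A₂.x) * (star A₁.x * A₁.θ (star E)) * (A₁.θ E * A₁.x * A₁.θ A₂.x)
        = A₁.θ (star A₂.x) * (star A₁.x * (A₁.θ (star E) * A₁.θ E) * A₁.x) * A₁.θ A₂.x := by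
          simp only [mul_assoc]
      _ = _ := by
          rw [e, mul_one, star_x_mul_x, sqrt_dim_mul, mul_smul_comm, mul_one, smul_mul_assoc,
            ← map_mul, star_x_mul_x, map_smul, map_one, smul_smul]
          push_cast; rfl

lemma prod_d (A₁ A₂ : QSystem N) (E : N) (h : IsExchange A₁ A₂ E) :
    (A₁.prod A₂ E h).d = A₁.d * A₂.d := sqrt_dim_mul A₁ A₂

end QSystem

/-! ### The unit of a Q-system as an intermediate Q-system. -/

namespace QSystem

open Ext

section Intermediate

lemma ofReal_inv_sqrt_mul_self (A : QSystem N) :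
    (((√A.d)⁻¹ : ℝ) : ℂ) * (((√A.d)⁻¹ : ℝ) : ℂ) = (A.d : ℂ)⁻¹ := by
  rw [← Complex.ofReal_mul, ← mul_inv, Real.mul_self_sqrt A.d_nonneg, Complex.ofReal_inv]

/-- The isometry proportional to the unit `w` of a Q-system. -/
noncomputable def unitIsometry (A : QSystem N) : N := (((√A.d)⁻¹ : ℝ) : ℂ) • A.w

/-- The Jones projection of a Q-system. -/
noncomputable def unitProj (A : QSystem N) : N := (A.d : ℂ)⁻¹ • (A.w * star A.w)

lemma d_ne_zero [Nontrivial N] (A : QSystem N) : (A.d : ℂ) ≠ 0 := Complex.ofReal_ne_zero.2 A.d_pos.ne'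

lemma star_unitIsometry (A : QSystem N) :
    star A.unitIsometry = (((√A.d)⁻¹ : ℝ) : ℂ) • star A.w := by
  rw [unitIsometry, star_smul, Complex.star_def, Complex.conj_ofReal]

/-- The scalars met when reducing `x`: the prefactor, three normalized copies of the unit, and one
`w* w`. -/
lemma sqrt_d_mul_inv_cube [Nontrivial N] (A : QSystem N) :
    ((√A.d : ℝ) : ℂ) * ((((√A.d)⁻¹ : ℝ) : ℂ) * ((((√A.d)⁻¹ : ℝ) : ℂ) *
      ((((√A.d)⁻¹ : ℝ) : ℂ) * (A.d : ℂ)))) = 1 := by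
  have hr : √A.d ≠ 0 := (Real.sqrt_pos.2 A.d_pos).ne'
  have hd := Real.mul_self_sqrt A.d_nonneg
  rw [← Complex.ofReal_mul, ← Complex.ofReal_mul, ← Complex.ofReal_mul, ← Complex.ofReal_mul]
  norm_cast
  generalize √A.d = r at *
  rw [← hd]
  field_simp

lemma star_unitIsometry_mul_self [Nontrivial N] (A : QSystem N) : star A.unitIsometry * A.unitIsometry = 1 := by
  rw [star_unitIsometry, unitIsometry, smul_mul_smul_comm, star_w_mul_w, smul_smul,
    ofReal_inv_sqrt_mul_self, inv_mul_cancel₀ A.d_ne_zero, one_smul]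

lemma unitIsometry_mul_star (A : QSystem N) : A.unitIsometry * star A.unitIsometry = A.unitProj := by
  rw [star_unitIsometry, unitIsometry, smul_mul_smul_comm, ofReal_inv_sqrt_mul_self, unitProj]

lemma unitIsometry_mem (A : QSystem N) : A.unitIsometry ∈ Hom 1 A.θ := Hom.smul_mem _ A.w_mem

lemma unitProj_mul_w [Nontrivial N] (A : QSystem N) : A.unitProj * A.w = A.w := by
  rw [unitProj, smul_mul_assoc, mul_assoc, star_w_mul_w, mul_smul_comm, mul_one, smul_smul,
    inv_mul_cancel₀ A.d_ne_zero, one_smul]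

lemma unitProj_comm (A : QSystem N) (a : N) : A.unitProj * A.θ a = A.θ a * A.unitProj := by
  rw [unitProj, smul_mul_assoc, mul_smul_comm, mul_assoc, star_w_comm, ← mul_assoc, w_comm,
    mul_assoc]

/-- The unit law collapses the compression. The next two lemmas bring the other compressions to the
same value, which is the intermediate condition for the trivial Q-system. -/
lemma unitProj_mul_x_mul (A : QSystem N) :
    A.unitProj * A.x * A.unitProj = (A.d : ℂ)⁻¹ • (A.w * A.unitProj) := by
  simp only [unitProj, smul_mul_assoc, mul_smul_comm]
  rw [← mul_assoc, mul_assoc A.w, A.unit_left, mul_one, mul_assoc]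

lemma unitProj_mul_θ_mul_x (A : QSystem N) :
    A.unitProj * A.θ A.unitProj * A.x = A.unitProj * A.x * A.unitProj := by
  rw [unitProj_mul_x_mul]
  simp only [unitProj, smul_mul_assoc, mul_smul_comm, map_smul, map_mul]
  rw [mul_assoc, mul_assoc (A.θ A.w), A.unit_right, mul_one, mul_assoc, star_w_comm]

lemma θ_unitProj_mul_x_mul (A : QSystem N) :
    A.θ A.unitProj * A.x * A.unitProj = A.unitProj * A.x * A.unitProj := by
  rw [unitProj_mul_x_mul]
  simp only [unitProj, smul_mul_assoc, mul_smul_comm, map_smul, map_mul]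
  rw [mul_assoc (A.θ A.w), A.unit_right, mul_one, ← mul_assoc, ← w_comm, mul_assoc]

lemma unitProj_mul_exchange {A₁ A₂ : QSystem N} {E : N} (h : IsExchange A₁ A₂ E) :
    A₂.unitProj * E = E * A₁.θ A₂.unitProj := by
  rw [unitProj, map_smul, smul_mul_assoc, mul_smul_comm, map_mul, ← mul_assoc, h.mul_w₂, mul_assoc,
    h.star_w₂_mul]

lemma θ_unitProj_mul_exchange {A₁ A₂ : QSystem N} {E : N} (h : IsExchange A₁ A₂ E) :
    A₂.θ A₁.unitProj * E = E * A₁.unitProj := by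
  rw [unitProj, map_smul, smul_mul_assoc, mul_smul_comm, map_mul, mul_assoc, h.θ_star_w₁_mul,
    ← h.mul_w₁, mul_assoc]

end Intermediate

/-! ### The two factors inside the braided product and its extension. -/

section Product

variable [Nontrivial N] [Algebra.IsCentral ℂ N] {A₁ A₂ : QSystem N} {E : N}
  (h : IsExchange A₁ A₂ E)

@[simp] lemma prod_θ_apply (a : N) : (A₁.prod A₂ E h).θ a = A₁.θ (A₂.θ a) := rfl

/-- The projection is `θ₁(p₂)`, with `p₂` the Jones projection of `A₂`. It slides through `E` and
`x₁`, which leaves the identities between `p₂` and `x₂`. -/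
lemma isIntermediate_prod_left :
    IsIntermediate A₁ (A₁.prod A₂ E h) (A₁.θ A₂.unitIsometry) where
  isometry := by rw [← map_star, ← map_mul, star_unitIsometry_mul_self, map_one]
  s_mem := Hom.map_mem A₁.θ A₂.unitIsometry_mem
  θ_eq a := by
    rw [prod_θ_apply, mul_assoc, ← map_mul, ← A₂.unitIsometry_mem a, map_mul, ← mul_assoc,
      ← map_star, ← map_mul, star_unitIsometry_mul_self, map_one, one_mul]
    rfl
  p_w := by
    rw [prod_w, ← map_star, ← map_mul, unitIsometry_mul_star, ← mul_assoc, ← map_mul,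
      unitProj_mul_w]
  p_x := by
    rw [prod_x, prod_θ_apply, ← map_star, ← map_mul, unitIsometry_mul_star]
    calc A₁.θ A₂.unitProj * A₁.θ (A₂.θ (A₁.θ A₂.unitProj)) * (A₁.θ E * A₁.x * A₁.θ A₂.x)
        = A₁.θ (A₂.unitProj * (A₂.θ (A₁.θ A₂.unitProj) * E)) * A₁.x * A₁.θ A₂.x := by
          simp only [map_mul, mul_assoc]
      _ = A₁.θ (A₂.unitProj * E) * (A₁.θ (A₁.θ (A₂.θ A₂.unitProj)) * A₁.x) * A₁.θ A₂.x := by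
          rw [h.comm]; simp only [map_mul, mul_assoc]
      _ = A₁.θ (A₂.unitProj * E) * (A₁.x * A₁.θ (A₂.θ A₂.unitProj)) * A₁.θ A₂.x := by rw [x_comm]
      _ = A₁.θ E * (A₁.θ (A₁.θ A₂.unitProj) * A₁.x) * A₁.θ (A₂.θ A₂.unitProj * A₂.x) := by
          rw [unitProj_mul_exchange h]; simp only [map_mul, mul_assoc]
      _ = A₁.θ E * A₁.x * A₁.θ (A₂.unitProj * A₂.θ A₂.unitProj * A₂.x) := by
          rw [← x_comm]; simp only [map_mul, mul_assoc]
      _ = A₁.θ E * (A₁.x * A₁.θ A₂.unitProj) * A₁.θ (A₂.x * A₂.unitProj) := by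
          rw [unitProj_mul_θ_mul_x]; simp only [map_mul, mul_assoc]
      _ = A₁.θ (E * A₁.θ A₂.unitProj) * A₁.x * A₁.θ (A₂.x * A₂.unitProj) := by
          rw [x_comm]; simp only [map_mul, mul_assoc]
      _ = _ := by rw [← unitProj_mul_exchange h]; simp only [map_mul, mul_assoc]
  p_x' := by
    rw [prod_x, prod_θ_apply, ← map_star, ← map_mul, unitIsometry_mul_star]
    calc A₁.θ A₂.unitProj * (A₁.θ E * A₁.x * A₁.θ A₂.x) * A₁.θ A₂.unitProj
        = A₁.θ (A₂.unitProj * E) * A₁.x * A₁.θ (A₂.x * A₂.unitProj) := by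
          simp only [map_mul, mul_assoc]
      _ = A₁.θ E * (A₁.θ (A₁.θ A₂.unitProj) * A₁.x) * A₁.θ (A₂.x * A₂.unitProj) := by
          rw [unitProj_mul_exchange h]; simp only [map_mul, mul_assoc]
      _ = A₁.θ E * A₁.x * A₁.θ (A₂.unitProj * A₂.x * A₂.unitProj) := by
          rw [← x_comm]; simp only [map_mul, mul_assoc]
      _ = A₁.θ E * (A₁.x * A₁.θ (A₂.θ A₂.unitProj)) * A₁.θ (A₂.x * A₂.unitProj) := by
          rw [← θ_unitProj_mul_x_mul]; simp only [map_mul, mul_assoc]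
      _ = A₁.θ (E * A₁.θ (A₂.θ A₂.unitProj)) * A₁.x * A₁.θ (A₂.x * A₂.unitProj) := by
          rw [x_comm]; simp only [map_mul, mul_assoc]
      _ = _ := by rw [← h.comm]; simp only [map_mul, mul_assoc]
  w_eq := by
    have hd : √(A₁.d / (A₁.d * A₂.d)) = (√A₂.d)⁻¹ := by
      rw [div_mul_cancel_left₀ A₁.d_pos.ne', Real.sqrt_inv]
    rw [prod_d, hd, prod_w, ← map_star, ← mul_assoc, ← map_mul, star_unitIsometry, smul_mul_assoc,
      star_w_mul_w, map_smul, smul_mul_assoc, smul_smul, ofReal_inv_sqrt_mul_self, map_smul, map_one,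
      smul_mul_assoc, one_mul, smul_smul, inv_mul_cancel₀ A₂.d_ne_zero, one_smul]
  x_eq := by
    have hd : √(A₁.d * A₂.d / A₁.d) = √A₂.d := by rw [mul_div_cancel_left₀ _ A₁.d_pos.ne']
    have e : A₁.θ (star A₂.w) * A₁.θ (A₂.θ (A₁.θ (star A₂.w))) * (A₁.θ E * A₁.x * A₁.θ A₂.x) *
        A₁.θ A₂.w = (A₂.d : ℂ) • A₁.x := by
      calc A₁.θ (star A₂.w) * A₁.θ (A₂.θ (A₁.θ (star A₂.w))) * (A₁.θ E * A₁.x * A₁.θ A₂.x) *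
            A₁.θ A₂.w
          = A₁.θ (star A₂.w * (A₂.θ (A₁.θ (star A₂.w)) * E)) * A₁.x * A₁.θ (A₂.x * A₂.w) := by
            simp only [map_mul, mul_assoc]
        _ = A₁.θ (star A₂.w * E * A₁.θ (A₂.θ (star A₂.w))) * A₁.x * A₁.θ (A₂.x * A₂.w) := by
            rw [h.comm]; simp only [mul_assoc]
        _ = A₁.θ (A₁.θ (star A₂.w * A₂.θ (star A₂.w))) * A₁.x * A₁.θ (A₂.x * A₂.w) := by
            rw [h.star_w₂_mul]; simp only [map_mul]
        _ = A₁.x * A₁.θ (star A₂.w * (A₂.θ (star A₂.w) * A₂.x) * A₂.w) := by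
            rw [← x_comm]; simp only [map_mul, mul_assoc]
        _ = _ := by
            rw [A₂.unit_right, mul_one, star_w_mul_w, map_smul, map_one, mul_smul_comm, mul_one]
    rw [prod_d, hd, prod_x, prod_θ_apply, ← map_star, star_unitIsometry, unitIsometry]
    simp only [map_smul, smul_mul_assoc, mul_smul_comm]
    rw [e]
    simp only [smul_smul]
    rw [sqrt_d_mul_inv_cube, one_smul]

/-- Here the projection is the Jones projection of `A₁`. It commutes with the image of `θ₁` and
slides through `E`, which leaves its identities with `x₁`. -/
lemma isIntermediate_prod_right :
    IsIntermediate A₂ (A₁.prod A₂ E h) A₁.unitIsometry where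
  isometry := A₁.star_unitIsometry_mul_self
  s_mem := Hom.mul_right_mem A₂.θ A₁.unitIsometry_mem
  θ_eq a := by
    have e := A₁.unitIsometry_mem (A₂.θ a)
    change A₁.unitIsometry * A₂.θ a = _ at e
    rw [prod_θ_apply, mul_assoc, ← e, ← mul_assoc, star_unitIsometry_mul_self, one_mul]
  p_w := by
    rw [prod_w, unitIsometry_mul_star, ← mul_assoc, unitProj_comm, mul_assoc, unitProj_mul_w]
  p_x := by
    rw [prod_x, prod_θ_apply, unitIsometry_mul_star]
    calc A₁.unitProj * A₁.θ (A₂.θ A₁.unitProj) * (A₁.θ E * A₁.x * A₁.θ A₂.x)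
        = A₁.unitProj * A₁.θ (A₂.θ A₁.unitProj * E) * A₁.x * A₁.θ A₂.x := by
          simp only [map_mul, mul_assoc]
      _ = A₁.θ E * (A₁.unitProj * A₁.θ A₁.unitProj * A₁.x) * A₁.θ A₂.x := by
          rw [θ_unitProj_mul_exchange h, map_mul, ← mul_assoc, unitProj_comm]
          simp only [mul_assoc]
      _ = A₁.θ E * A₁.unitProj * A₁.x * (A₁.unitProj * A₁.θ A₂.x) := by
          rw [unitProj_mul_θ_mul_x]; simp only [mul_assoc]
      _ = A₁.unitProj * A₁.θ E * A₁.x * (A₁.θ A₂.x * A₁.unitProj) := by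
          rw [unitProj_comm _ E, unitProj_comm _ A₂.x]
      _ = _ := by simp only [mul_assoc]
  p_x' := by
    rw [prod_x, prod_θ_apply, unitIsometry_mul_star]
    calc A₁.unitProj * (A₁.θ E * A₁.x * A₁.θ A₂.x) * A₁.unitProj
        = A₁.unitProj * A₁.θ E * A₁.x * (A₁.θ A₂.x * A₁.unitProj) := by simp only [mul_assoc]
      _ = A₁.θ E * (A₁.unitProj * A₁.x * A₁.unitProj) * A₁.θ A₂.x := by
          rw [unitProj_comm, ← unitProj_comm _ A₂.x]; simp only [mul_assoc]
      _ = A₁.θ (E * A₁.unitProj) * A₁.x * (A₁.unitProj * A₁.θ A₂.x) := by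
          rw [← θ_unitProj_mul_x_mul]; simp only [map_mul, mul_assoc]
      _ = _ := by
          rw [unitProj_comm, ← θ_unitProj_mul_exchange h]; simp only [map_mul, mul_assoc]
  w_eq := by
    have hd : √(A₂.d / (A₁.d * A₂.d)) = (√A₁.d)⁻¹ := by
      rw [div_mul_cancel_right₀ A₂.d_pos.ne', Real.sqrt_inv]
    rw [prod_d, hd, prod_w, ← w_comm, ← mul_assoc, star_unitIsometry, smul_mul_assoc,
      star_w_mul_w, smul_smul, smul_mul_assoc, one_mul, smul_smul, ← mul_assoc,
      ofReal_inv_sqrt_mul_self, inv_mul_cancel₀ A₁.d_ne_zero, one_smul]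
  x_eq := by
    have hd : √(A₁.d * A₂.d / A₂.d) = √A₁.d := by rw [mul_div_cancel_right₀ _ A₂.d_pos.ne']
    have e : star A₁.w * A₁.θ (A₂.θ (star A₁.w)) * (A₁.θ E * A₁.x * A₁.θ A₂.x) * A₁.w =
        (A₁.d : ℂ) • A₂.x := by
      calc star A₁.w * A₁.θ (A₂.θ (star A₁.w)) * (A₁.θ E * A₁.x * A₁.θ A₂.x) * A₁.w
          = star A₁.w * A₁.θ (A₂.θ (star A₁.w) * E) * A₁.x * (A₁.θ A₂.x * A₁.w) := by
            simp only [map_mul, mul_assoc]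
        _ = star A₁.w * (A₁.θ (star A₁.w) * A₁.x) * (A₁.w * A₂.x) := by
            rw [h.θ_star_w₁_mul, w_comm]; simp only [mul_assoc]
        _ = _ := by
            rw [A₁.unit_right, mul_one, ← mul_assoc, star_w_mul_w, smul_mul_assoc, one_mul]
    rw [prod_d, hd, prod_x, prod_θ_apply, star_unitIsometry, unitIsometry]
    simp only [map_smul, smul_mul_assoc, mul_smul_comm]
    rw [e]
    simp only [smul_smul]
    rw [sqrt_d_mul_inv_cube, one_smul]

/-- The embedding of the first factor into the extension of the braided product. -/
noncomputable def extInl : A₁.Ext →⋆ₐ[ℂ] (A₁.prod A₂ E h).Ext where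
  -- Forced by `v = v₁v₂`: `θ₁(w₂*) v₁v₂ = v₁ w₂* v₂ = v₁`.
  toFun b := ⟨b.coeff * A₁.θ (star A₂.w)⟩
  map_one' := by ext; simp [map_star]
  map_mul' b c := by
    ext
    simp only [coeff_mul, prod_θ_apply, prod_x]
    symm
    calc b.coeff * A₁.θ (star A₂.w) * A₁.θ (A₂.θ (c.coeff * A₁.θ (star A₂.w))) *
          (A₁.θ E * A₁.x * A₁.θ A₂.x)
        = b.coeff * A₁.θ (star A₂.w * A₂.θ c.coeff * (A₂.θ (A₁.θ (star A₂.w)) * E)) * A₁.x *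
            A₁.θ A₂.x := by simp only [map_mul, mul_assoc]
      _ = b.coeff * A₁.θ (c.coeff * (star A₂.w * E) * A₁.θ (A₂.θ (star A₂.w))) * A₁.x *
            A₁.θ A₂.x := by rw [h.comm, star_w_comm]; simp only [mul_assoc]
      _ = b.coeff * A₁.θ c.coeff * (A₁.θ (A₁.θ (star A₂.w * A₂.θ (star A₂.w))) * A₁.x) *
            A₁.θ A₂.x := by rw [h.star_w₂_mul]; simp only [map_mul, mul_assoc]
      _ = b.coeff * A₁.θ c.coeff * A₁.x * A₁.θ (star A₂.w * (A₂.θ (star A₂.w) * A₂.x)) := by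
          rw [← x_comm]; simp only [map_mul, mul_assoc]
      _ = _ := by rw [A₂.unit_right, mul_one]
  map_zero' := by ext; simp
  map_add' b c := by ext; simp [add_mul]
  commutes' z := by ext; simp [Algebra.algebraMap_eq_smul_one, map_star]
  map_star' b := by
    ext
    simp only [coeff_star, prod_θ_apply, prod_x, prod_w, star_mul, ← map_star, star_star]
    symm
    have e : A₁.θ (A₂.θ A₂.w) * star E = star E * A₂.θ (A₁.θ A₂.w) := h.symm.comm _
    have e' : A₁.θ (star A₂.w) * star E = star A₂.w := h.symm.θ_star_w₁_mul
    calc star A₁.w * A₁.θ (star A₂.w) * (A₁.θ (star A₂.x) * (star A₁.x * A₁.θ (star E))) *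
          A₁.θ (A₂.θ (A₁.θ A₂.w * star b.coeff))
        = star A₁.w * A₁.θ (star A₂.w * star A₂.x) * star A₁.x *
            A₁.θ (star E * A₂.θ (A₁.θ A₂.w) * A₂.θ (star b.coeff)) := by
          simp only [map_mul, mul_assoc]
      _ = star A₁.w * A₁.θ (star A₂.w * star A₂.x) * (star A₁.x * A₁.θ (A₁.θ (A₂.θ A₂.w))) *
            A₁.θ (star E * A₂.θ (star b.coeff)) := by
          rw [← e]; simp only [map_mul, mul_assoc]
      _ = star A₁.w * A₁.θ (star A₂.w * (star A₂.x * A₂.θ A₂.w)) * star A₁.x *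
            A₁.θ (star E * A₂.θ (star b.coeff)) := by
          rw [star_x_comm]; simp only [map_mul, mul_assoc]
      _ = star A₁.w * star A₁.x * A₁.θ (A₁.θ (star A₂.w) * star E * A₂.θ (star b.coeff)) := by
          rw [star_x_mul_θ_w, mul_one, mul_assoc (star A₁.w), ← star_x_comm]
          simp only [map_mul, mul_assoc]
      _ = _ := by rw [e', star_w_comm, map_mul]; simp only [mul_assoc]

/-- The embedding of the second factor into the extension of the braided product. -/
noncomputable def extInr : A₂.Ext →⋆ₐ[ℂ] (A₁.prod A₂ E h).Ext where
  -- Forced by `v = v₁v₂`: `w₁* v₁v₂ = v₂`.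
  toFun b := ⟨b.coeff * star A₁.w⟩
  map_one' := by ext; simp [← map_star, star_w_comm]
  map_mul' b c := by
    ext
    simp only [coeff_mul, prod_θ_apply, prod_x]
    symm
    calc b.coeff * star A₁.w * A₁.θ (A₂.θ (c.coeff * star A₁.w)) * (A₁.θ E * A₁.x * A₁.θ A₂.x)
        = b.coeff * (star A₁.w * A₁.θ (A₂.θ c.coeff)) * A₁.θ (A₂.θ (star A₁.w) * E) * A₁.x *
            A₁.θ A₂.x := by simp only [map_mul, mul_assoc]
      _ = b.coeff * A₂.θ c.coeff * star A₁.w * (A₁.θ (star A₁.w) * A₁.x) * A₁.θ A₂.x := by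
          rw [h.θ_star_w₁_mul, star_w_comm]; simp only [mul_assoc]
      _ = _ := by rw [A₁.unit_right, mul_one, mul_assoc _ (star A₁.w), star_w_comm, mul_assoc _ A₂.x]
  map_zero' := by ext; simp
  map_add' b c := by ext; simp [add_mul]
  commutes' z := by ext; simp [Algebra.algebraMap_eq_smul_one, ← map_star, star_w_comm]
  map_star' b := by
    ext
    simp only [coeff_star, prod_θ_apply, prod_x, prod_w, star_mul, ← map_star, star_star]
    symm
    have e : star E * A₂.θ A₁.w = A₁.w := h.symm.mul_w₂
    calc star A₁.w * A₁.θ (star A₂.w) * (A₁.θ (star A₂.x) * (star A₁.x * A₁.θ (star E))) *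
          A₁.θ (A₂.θ (A₁.w * star b.coeff))
        = star A₁.w * A₁.θ (star A₂.w * star A₂.x) * star A₁.x *
            A₁.θ (star E * A₂.θ A₁.w * A₂.θ (star b.coeff)) := by
          simp only [map_mul, mul_assoc]
      _ = star A₁.w * A₁.θ (star A₂.w * star A₂.x) * (star A₁.x * A₁.θ A₁.w) *
            A₁.θ (A₂.θ (star b.coeff)) := by
          rw [e]; simp only [map_mul, mul_assoc]
      _ = star A₁.w * A₁.θ (star A₂.w * star A₂.x * A₂.θ (star b.coeff)) := by
          rw [star_x_mul_θ_w, mul_one]; simp only [map_mul, mul_assoc]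
      _ = _ := by rw [star_w_comm]

@[simp] lemma coeff_extInl (b : A₁.Ext) :
    (extInl h b).coeff = b.coeff * A₁.θ (star A₂.w) := rfl

@[simp] lemma coeff_extInr (b : A₂.Ext) : (extInr h b).coeff = b.coeff * star A₁.w := rfl

lemma extInl_injective : Function.Injective (extInl h) := by
  intro b c hbc
  -- Multiplying by `θ₁(w₂)` recovers the coefficient up to the nonzero factor `d₂`.
  have e := congrArg (fun z => z.coeff * A₁.θ A₂.w) hbc
  simp only [coeff_extInl, mul_assoc, ← map_mul, star_w_mul_w, map_smul, map_one, mul_smul_comm,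
    mul_one] at e
  exact Ext.ext (smul_right_injective N A₂.d_ne_zero e)

lemma extInr_injective : Function.Injective (extInr h) := by
  intro b c hbc
  have e := congrArg (fun z => z.coeff * A₁.w) hbc
  simp only [coeff_extInr, mul_assoc, star_w_mul_w, mul_smul_comm, mul_one] at e
  exact Ext.ext (smul_right_injective N A₁.d_ne_zero e)

lemma extInl_ι (a : N) : extInl h (A₁.ι a) = (A₁.prod A₂ E h).ι a := by
  ext
  change a * star A₁.w * A₁.θ (star A₂.w) = a * star (A₁.θ A₂.w * A₁.w)
  rw [star_mul, map_star, mul_assoc]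

lemma extInr_ι (a : N) : extInr h (A₂.ι a) = (A₁.prod A₂ E h).ι a := by
  ext
  change a * star A₂.w * star A₁.w = a * star (A₁.θ A₂.w * A₁.w)
  rw [star_mul, ← map_star, star_w_comm, mul_assoc]

lemma extInl_v : extInl h A₁.v = ((√((A₁.prod A₂ E h).d / A₁.d) : ℝ) : ℂ) •
    ((A₁.prod A₂ E h).ι (star (A₁.θ A₂.unitIsometry)) * (A₁.prod A₂ E h).v) := by
  have hr : √A₂.d ≠ 0 := (Real.sqrt_pos.2 A₂.d_pos).ne'
  ext
  rw [ι_mul_v, prod_d, mul_div_cancel_left₀ _ A₁.d_pos.ne', ← map_star, star_unitIsometry,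
    coeff_smul, map_smul, smul_smul, ← Complex.ofReal_mul, mul_inv_cancel₀ hr, Complex.ofReal_one,
    one_smul]
  exact one_mul _

lemma extInr_v : extInr h A₂.v = ((√((A₁.prod A₂ E h).d / A₂.d) : ℝ) : ℂ) •
    ((A₁.prod A₂ E h).ι (star A₁.unitIsometry) * (A₁.prod A₂ E h).v) := by
  have hr : √A₁.d ≠ 0 := (Real.sqrt_pos.2 A₁.d_pos).ne'
  ext
  rw [ι_mul_v, prod_d, mul_div_cancel_right₀ _ A₂.d_pos.ne', star_unitIsometry,
    coeff_smul, smul_smul, ← Complex.ofReal_mul, mul_inv_cancel₀ hr, Complex.ofReal_one,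
    one_smul]
  exact one_mul _

lemma extInl_v_mul_extInr_v : extInl h A₁.v * extInr h A₂.v = (A₁.prod A₂ E h).v := by
  ext
  change 1 * A₁.θ (star A₂.w) * A₁.θ (A₂.θ (1 * star A₁.w)) * (A₁.θ E * A₁.x * A₁.θ A₂.x) = 1
  calc 1 * A₁.θ (star A₂.w) * A₁.θ (A₂.θ (1 * star A₁.w)) * (A₁.θ E * A₁.x * A₁.θ A₂.x)
      = A₁.θ (star A₂.w) * A₁.θ (A₂.θ (star A₁.w) * E) * A₁.x * A₁.θ A₂.x := by
        simp only [one_mul, map_mul, mul_assoc]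
    _ = A₁.θ (star A₂.w) * (A₁.θ (star A₁.w) * A₁.x) * A₁.θ A₂.x := by
        rw [h.θ_star_w₁_mul]; simp only [mul_assoc]
    _ = 1 := by rw [A₁.unit_right, mul_one, ← map_mul, A₂.unit_left, map_one]

/-- Both sides have coefficient `E`: on the right because `v₁v₂ = v`, on the left by sliding
`θ₁(w₂*)` through `E` and using the unit laws. -/
lemma extInr_v_mul_extInl_v :
    extInr h A₂.v * extInl h A₁.v = extInl h (A₁.ι E) * extInl h A₁.v * extInr h A₂.v := by
  rw [mul_assoc, extInl_v_mul_extInr_v, extInl_ι, ι_mul_v]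
  ext
  change 1 * star A₁.w * A₁.θ (A₂.θ (1 * A₁.θ (star A₂.w))) * (A₁.θ E * A₁.x * A₁.θ A₂.x) = E
  calc 1 * star A₁.w * A₁.θ (A₂.θ (1 * A₁.θ (star A₂.w))) * (A₁.θ E * A₁.x * A₁.θ A₂.x)
      = star A₁.w * A₁.θ (A₂.θ (A₁.θ (star A₂.w)) * E) * A₁.x * A₁.θ A₂.x := by
        simp only [one_mul, map_mul, mul_assoc]
    _ = E * A₁.θ (A₂.θ (star A₂.w)) * (star A₁.w * A₁.x) * A₁.θ A₂.x := by
        rw [h.comm, star_w_comm]; simp only [mul_assoc]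
    _ = E := by
        rw [A₁.unit_left, mul_one, mul_assoc, ← map_mul, A₂.unit_right, map_one, mul_one]

end Product

/-! ### The extension as a quotient of the free product. -/

section Quotient

variable (A₁ A₂ : QSystem N)

/-- A pair of homomorphisms on the two extensions, as a family indexed by `Fin 2`. -/
noncomputable def freeProdMaps {D : Type*} [Ring D] [Algebra ℂ D] (f : A₁.Ext →ₐ[ℂ] D)
    (g : A₂.Ext →ₐ[ℂ] D) {i : Fin 2} : (![A₁, A₂] i).Ext →ₐ[ℂ] D :=
  match i with
  | 0 => f
  | 1 => g

/-- The homomorphism out of the free product defined by a pair of homomorphisms. -/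
noncomputable def freeProdLift {D : Type*} [Ring D] [Algebra ℂ D] (f : A₁.Ext →ₐ[ℂ] D)
    (g : A₂.Ext →ₐ[ℂ] D) : FreeProd A₁ A₂ →ₐ[ℂ] D :=
  LinearAlgebra.FreeProduct.lift ℂ (fun i : Fin 2 => (![A₁, A₂] i).Ext) (freeProdMaps A₁ A₂ f g)

variable {A₁ A₂}

@[simp] lemma freeProdLift_inl {D : Type*} [Ring D] [Algebra ℂ D] (f : A₁.Ext →ₐ[ℂ] D)
    (g : A₂.Ext →ₐ[ℂ] D) (b : A₁.Ext) : freeProdLift A₁ A₂ f g (inl A₁ A₂ b) = f b :=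
  DFunLike.congr_fun (LinearAlgebra.FreeProduct.lift_comp_ι ℂ
    (fun i : Fin 2 => (![A₁, A₂] i).Ext) (freeProdMaps A₁ A₂ f g) (i := 0)) b

@[simp] lemma freeProdLift_inr {D : Type*} [Ring D] [Algebra ℂ D] (f : A₁.Ext →ₐ[ℂ] D)
    (g : A₂.Ext →ₐ[ℂ] D) (b : A₂.Ext) : freeProdLift A₁ A₂ f g (inr A₁ A₂ b) = g b :=
  DFunLike.congr_fun (LinearAlgebra.FreeProduct.lift_comp_ι ℂ
    (fun i : Fin 2 => (![A₁, A₂] i).Ext) (freeProdMaps A₁ A₂ f g) (i := 1)) b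

lemma freeProd_hom_ext {D : Type*} [Semiring D] [Algebra ℂ D] {f g : FreeProd A₁ A₂ →ₐ[ℂ] D}
    (h₁ : ∀ b, f (inl A₁ A₂ b) = g (inl A₁ A₂ b)) (h₂ : ∀ b, f (inr A₁ A₂ b) = g (inr A₁ A₂ b)) :
    f = g := by
  let A : Fin 2 → Type u := fun i => (![A₁, A₂] i).Ext
  have hf : f = LinearAlgebra.FreeProduct.lift ℂ A
      (fun {i} => g.comp (LinearAlgebra.FreeProduct.ι ℂ A i)) := by
    refine LinearAlgebra.FreeProduct.lift_unique ℂ A _ f fun i => ?_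
    fin_cases i
    · exact AlgHom.ext h₁
    · exact AlgHom.ext h₂
  rw [hf]
  exact (LinearAlgebra.FreeProduct.lift_unique ℂ A _ g fun _ => rfl).symm

lemma ext_hom_ext {A : QSystem N} {D : Type*} [Semiring D] [Algebra ℂ D] {f g : A.Ext →ₐ[ℂ] D}
    (hι : ∀ a, f (A.ι a) = g (A.ι a)) (hv : f A.v = g A.v) : f = g := by
  ext b
  have hb : b = A.ι b.coeff * A.v := (A.ι_mul_v b.coeff).symm
  rw [hb, map_mul, map_mul, hι, hv]

/-- The extension of the braided product is the quotient of the free product by the exchange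
relation. -/
lemma exists_prodQuot_equiv [Nontrivial N] [Algebra.IsCentral ℂ N] {E : N}
    (h : IsExchange A₁ A₂ E) :
    ∃ e : ProdQuot A₁ A₂ E ≃ₐ[ℂ] (A₁.prod A₂ E h).Ext,
      (∀ b, e (toProdQuot A₁ A₂ E (inl A₁ A₂ b)) = extInl h b) ∧
      (∀ b, e (toProdQuot A₁ A₂ E (inr A₁ A₂ b)) = extInr h b) := by
  set A := A₁.prod A₂ E h
  set k₁ : A₁.Ext →ₐ[ℂ] ProdQuot A₁ A₂ E := (toProdQuot A₁ A₂ E).comp (inl A₁ A₂) with hk₁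
  set k₂ : A₂.Ext →ₐ[ℂ] ProdQuot A₁ A₂ E := (toProdQuot A₁ A₂ E).comp (inr A₁ A₂) with hk₂
  have hι (a : N) : k₁ (A₁.ι a) = k₂ (A₂.ι a) :=
    RingQuot.mkAlgHom_rel ℂ (ProdRel.identify a)
  have hvv : k₂ A₂.v * k₁ A₁.v = k₁ (A₁.ι E) * k₁ A₁.v * k₂ A₂.v := by
    have := RingQuot.mkAlgHom_rel ℂ (ProdRel.comm (A₁ := A₁) (A₂ := A₂) (e := E))
    rwa [map_mul, map_mul, map_mul] at this
  let F : ProdQuot A₁ A₂ E →ₐ[ℂ] A.Ext := RingQuot.liftAlgHom ℂ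
    ⟨freeProdLift A₁ A₂ (extInl h).toAlgHom (extInr h).toAlgHom, fun x y hxy => by
      cases hxy with
      | identify a =>
        rw [freeProdLift_inl, freeProdLift_inr]
        exact (extInl_ι h a).trans (extInr_ι h a).symm
      | comm =>
        rw [map_mul, map_mul, map_mul, freeProdLift_inl, freeProdLift_inl, freeProdLift_inr]
        exact extInr_v_mul_extInl_v h⟩
  have hF (x) : F (toProdQuot A₁ A₂ E x) =
      freeProdLift A₁ A₂ (extInl h).toAlgHom (extInr h).toAlgHom x :=
    RingQuot.liftAlgHom_mkAlgHom_apply ..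
  have hF₁ (b) : F (k₁ b) = extInl h b := (hF _).trans (freeProdLift_inl _ _ b)
  have hF₂ (b) : F (k₂ b) = extInr h b := (hF _).trans (freeProdLift_inr _ _ b)
  have vv₁ : k₁ A₁.v * k₁ A₁.v = k₁ (A₁.ι A₁.x) * k₁ A₁.v := by
    rw [← map_mul, A₁.v_relations.2.1, map_mul]
  have vv₂ : k₂ A₂.v * k₂ A₂.v = k₁ (A₁.ι A₂.x) * k₂ A₂.v := by
    rw [← map_mul, A₂.v_relations.2.1, map_mul, hι]
  have va₁ (a : N) : k₁ A₁.v * k₁ (A₁.ι a) = k₁ (A₁.ι (A₁.θ a)) * k₁ A₁.v := by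
    rw [← map_mul, A₁.v_relations.2.2.2, map_mul]
  have va₂ (a : N) : k₂ A₂.v * k₁ (A₁.ι a) = k₁ (A₁.ι (A₂.θ a)) * k₂ A₂.v := by
    rw [hι, ← map_mul, A₂.v_relations.2.2.2, map_mul, hι]
  have wv₁ : k₁ (A₁.ι (star A₁.w)) * k₁ A₁.v = 1 := by
    rw [← map_mul, A₁.v_relations.2.2.1, map_one]
  have wv₂ : k₁ (A₁.ι (star A₂.w)) * k₂ A₂.v = 1 := by
    rw [hι, ← map_mul, A₂.v_relations.2.2.1, map_one]
  -- The inverse sends `v` to `v₁v₂`. Only the algebraic relations have to be checked, so no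
  -- involution on the quotient is needed; the exchange relation enters in `v v = x v`.
  obtain ⟨G, ⟨hGι, hGv⟩, -⟩ := A.existsUnique_lift (k₁.comp A₁.ι.toAlgHom) (k₁ A₁.v * k₂ A₂.v)
    (by
      change _ = k₁ (A₁.ι (A₁.θ E * A₁.x * A₁.θ A₂.x)) * _
      calc k₁ A₁.v * k₂ A₂.v * (k₁ A₁.v * k₂ A₂.v)
          = k₁ A₁.v * (k₂ A₂.v * k₁ A₁.v) * k₂ A₂.v := by simp only [mul_assoc]
        _ = k₁ A₁.v * k₁ (A₁.ι E) * k₁ A₁.v * (k₂ A₂.v * k₂ A₂.v) := by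
            rw [hvv]; simp only [mul_assoc]
        _ = k₁ (A₁.ι (A₁.θ E)) * (k₁ A₁.v * k₁ A₁.v) * k₁ (A₁.ι A₂.x) * k₂ A₂.v := by
            rw [va₁, vv₂]; simp only [mul_assoc]
        _ = k₁ (A₁.ι (A₁.θ E)) * k₁ (A₁.ι A₁.x) * (k₁ A₁.v * k₁ (A₁.ι A₂.x)) * k₂ A₂.v := by
            rw [vv₁]; simp only [mul_assoc]
        _ = _ := by rw [va₁]; simp only [map_mul, mul_assoc])
    (by
      change k₁ (A₁.ι (star (A₁.θ A₂.w * A₁.w))) * _ = 1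
      rw [star_mul, ← map_star A₁.θ, map_mul, map_mul, mul_assoc, ← mul_assoc (k₁ (A₁.ι (A₁.θ _))),
        ← va₁, mul_assoc (k₁ A₁.v), wv₂, mul_one, wv₁])
    (fun a => by
      change _ * k₁ (A₁.ι a) = k₁ (A₁.ι (A₁.θ (A₂.θ a))) * _
      rw [mul_assoc, va₂, ← mul_assoc, va₁, mul_assoc])
  have hGι' (a : N) : G (A.ι a) = k₁ (A₁.ι a) := hGι a
  have hFG : F.comp G = AlgHom.id ℂ _ := by
    refine ext_hom_ext (fun a => ?_) ?_
    · exact (congrArg F (hGι' a)).trans ((hF₁ _).trans (extInl_ι h a))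
    · refine (congrArg F hGv).trans ?_
      rw [map_mul, hF₁, hF₂]
      exact extInl_v_mul_extInr_v h
  -- On `v₁` this is again `θ₁(w₂*) v₁v₂ = v₁ w₂* v₂ = v₁`, now computed in the quotient.
  have hG₁ : (G.comp (extInl h).toAlgHom) = k₁ := by
    refine ext_hom_ext (fun a => ?_) ?_
    · exact (congrArg G (extInl_ι h a)).trans (hGι' a)
    · change G ⟨1 * A₁.θ (star A₂.w)⟩ = _
      rw [one_mul, ← A.ι_mul_v, map_mul, hGι', hGv, ← mul_assoc, ← va₁, mul_assoc, wv₂, mul_one]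
  have hG₂ : (G.comp (extInr h).toAlgHom) = k₂ := by
    refine ext_hom_ext (fun a => ?_) ?_
    · exact (congrArg G (extInr_ι h a)).trans ((hGι' a).trans (hι a))
    · change G ⟨1 * star A₁.w⟩ = _
      rw [one_mul, ← A.ι_mul_v, map_mul, hGι', hGv, ← mul_assoc, wv₁, one_mul]
  have hGF : G.comp F = AlgHom.id ℂ _ := by
    refine RingQuot.ringQuot_ext' ℂ _ _ (freeProd_hom_ext (fun b => ?_) (fun b => ?_))
    · exact (congrArg G (hF₁ b)).trans (DFunLike.congr_fun hG₁ b)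
    · exact (congrArg G (hF₂ b)).trans (DFunLike.congr_fun hG₂ b)
  exact ⟨AlgEquiv.ofAlgHom F G hFG hGF, hF₁, hF₂⟩

end Quotient

end QSystem

end BraidedProduct

open BraidedProduct QSystem in
theorem proposition4p10 {N : Type*} [CStarAlgebra N] [Nontrivial N] [Algebra.IsCentral ℂ N]
    (C : BraidedCat N) (A₁ A₂ : QSystem N) (h₁ : A₁.θ ∈ C.obj) (h₂ : A₂.θ ∈ C.obj) (pm : Sign) :
    -- the triple is a Q-system `A` in the braided category
    ∃ A : QSystem N, A.θ ∈ C.obj ∧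
      A.θ = A₁.θ * A₂.θ ∧
      A.w = A₁.θ A₂.w * A₁.w ∧
      A.x = A₁.θ (C.braiding pm ⟨A₁.θ, h₁⟩ ⟨A₂.θ, h₂⟩) * A₁.x * A₁.θ A₂.x ∧
      -- `A₁` and `A₂` are intermediate Q-systems of `A`
      ∃ s₁ s₂ : N, IsIntermediate A₁ A s₁ ∧ IsIntermediate A₂ A s₂ ∧
        -- the corresponding intermediate extensions of `N`
        ∃ (j₁ : A₁.Ext →⋆ₐ[ℂ] A.Ext) (j₂ : A₂.Ext →⋆ₐ[ℂ] A.Ext),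
          Function.Injective j₁ ∧ Function.Injective j₂ ∧
          (∀ a, j₁ (A₁.ι a) = A.ι a) ∧ (∀ a, j₂ (A₂.ι a) = A.ι a) ∧
          j₁ A₁.v = ((√(A.d / A₁.d) : ℝ) : ℂ) • (A.ι (star s₁) * A.v) ∧
          j₂ A₂.v = ((√(A.d / A₂.d) : ℝ) : ℂ) • (A.ι (star s₂) * A.v) ∧
          -- the extension is the quotient of the free product by the stated relations
          ∃ e : ProdQuot A₁ A₂ (C.braiding pm ⟨A₁.θ, h₁⟩ ⟨A₂.θ, h₂⟩) ≃ₐ[ℂ] A.Ext,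
            (∀ b, e (toProdQuot A₁ A₂ _ (inl A₁ A₂ b)) = j₁ b) ∧
            (∀ b, e (toProdQuot A₁ A₂ _ (inr A₁ A₂ b)) = j₂ b) := by
  have h := C.isExchange A₁ A₂ h₁ h₂ pm
  exact ⟨A₁.prod A₂ _ h, mul_mem h₁ h₂, rfl, rfl, rfl, A₁.θ A₂.unitIsometry, A₁.unitIsometry,
    isIntermediate_prod_left h, isIntermediate_prod_right h, extInl h, extInr h,
    extInl_injective h, extInr_injective h, extInl_ι h, extInr_ι h, extInl_v h, extInr_v h,
    exists_prodQuot_equiv h⟩
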